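/- Let $n\ge 3$. Write $\mathbb R[x,y]$ for the polynomial ring in $x=(x_1,\dots,x_n)$ and $y=(y_1,\dots,y_n)$, $\mathbb R[x,y]_{1,1}$ for the space of bilinear biforms (polynomials homogeneous of degree $1$ in $x$ and of degree $1$ in $y$), $I$ for the ideal generated by $y^Tx=\sum_i x_iy_i$, and $I_{1,1}=I\cap\mathbb R[x,y]_{1,1}$. Let $T=\{(x,y)\in\mathbb R^n\times\mathbb R^n : x^Tx=y^Ty=1,\ y^Tx=0\}$ be the Stiefel manifold of orthonormal pairs, and let $\sigma$ be its $SO(n)$-invariant Borel probability measure, i.e. the image of the normalized Haar measure of $SO(n)$ under $U\mapsto (Ue_1,Ue_2)$. Every $g\in\mathbb R[x,y]_{1,1}/I_{1,1}$ defines a function on $T$; put $\|g\|_p=\left(\int_T|g|^p\,d\sigma\right)^{1/p}$. Call $g$ symmetric (resp. skew-symmetric) if $g=x^TAy+I_{1,1}$ for some symmetric (resp. skew-symmetric) matrix $A\in\mathbb R^{n\times n}$. Then for every $n\ge3$ and every $g\in\mathbb R[x,y]_{1,1}/I_{1,1}$, $$\Big(\int_T g^4\,d\sigma\Big)^{1/4}=\|g\|_4\le\sqrt6\,\|g\|_2=\sqrt6\,\Big(\int_T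 g^2\,d\sigma\Big)^{1/2}.$$ If $g$ is symmetric, then $\|g\|_4\le\sqrt3\,\|g\|_2$, and if $g$ is skew-symmetric, then $\|g\|_4\le\sqrt[4]{6}\,\|g\|_2$. The constants $\sqrt3$ and $\sqrt[4]6$ are asymptotically sharp as $n\to\infty$: there are symmetric (resp. skew-symmetric) forms $g_n\in\mathbb R[x,y]_{1,1}/I_{1,1}$ in $n+n$ variables, with $\|g_n\|_2>0$ for all $n\ge3$, such that $\|g_n\|_4/\|g_n\|_2\to\sqrt3$ (resp. $\to\sqrt[4]6$) as $n\to\infty$. -/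

import Mathlib

open MeasureTheory

noncomputable section

/-! ### Bilinear forms modulo the ideal `(yᵀx)` -/

/-- The polynomial ring `ℝ[x, y]` in two groups of variables `x = (x₁, …, xₙ)` (left summand)
and `y = (y₁, …, yₙ)` (right summand). -/
abbrev XYPoly (n : ℕ) : Type := MvPolynomial (Fin n ⊕ Fin n) ℝ

/-- The bidegree of a variable: `(1, 0)` for `xᵢ` and `(0, 1)` for `yᵢ`. -/
def xyBidegree (n : ℕ) : Fin n ⊕ Fin n → ℕ × ℕ :=
  Sum.elim (fun _ => (1, 0)) (fun _ => (0, 1))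

/-- The space `ℝ[x, y]_{k₁, k₂}` of biforms of bidegree `(k₁, k₂)`: polynomials homogeneous of
degree `k₁` in `x` and of degree `k₂` in `y`. -/
def biforms (n k₁ k₂ : ℕ) : Submodule ℝ (XYPoly n) :=
  MvPolynomial.weightedHomogeneousSubmodule ℝ (xyBidegree n) (k₁, k₂)

/-- The polynomial `yᵀx = ∑ᵢ xᵢ yᵢ`. -/
def orthPoly (n : ℕ) : XYPoly n :=
  ∑ i : Fin n, MvPolynomial.X (Sum.inl i) * MvPolynomial.X (Sum.inr i)

/-- The principal ideal `I = (yᵀx)` of `ℝ[x, y]`. -/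
def orthIdeal (n : ℕ) : Ideal (XYPoly n) := Ideal.span {orthPoly n}

/-- `I_{1,1} = I ∩ ℝ[x, y]_{1,1}`, as a subspace of `ℝ[x, y]_{1,1}`. -/
def orthIdealOneOne (n : ℕ) : Submodule ℝ (biforms n 1 1) :=
  ((orthIdeal n).restrictScalars ℝ).submoduleOf (biforms n 1 1)

/-- The space `ℝ[x, y]_{1,1} / I_{1,1}` of bilinear forms modulo `I`. -/
abbrev BilinModI (n : ℕ) : Type := biforms n 1 1 ⧸ orthIdealOneOne n

/-- The bilinear biform `xᵀ A y = ∑ᵢⱼ Aᵢⱼ xᵢ yⱼ`. -/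
def matrixPoly {n : ℕ} (A : Matrix (Fin n) (Fin n) ℝ) : XYPoly n :=
  ∑ i : Fin n, ∑ j : Fin n,
    MvPolynomial.C (A i j) * (MvPolynomial.X (Sum.inl i) * MvPolynomial.X (Sum.inr j))

theorem matrixPoly_mem {n : ℕ} (A : Matrix (Fin n) (Fin n) ℝ) :
    matrixPoly A ∈ biforms n 1 1 := by
  refine Submodule.sum_mem _ fun i _ => Submodule.sum_mem _ fun j _ => ?_
  rw [← MvPolynomial.smul_eq_C_mul]
  refine Submodule.smul_mem _ _ ?_
  have h := (MvPolynomial.isWeightedHomogeneous_X ℝ (xyBidegree n) (Sum.inl i)).mul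
    (MvPolynomial.isWeightedHomogeneous_X ℝ (xyBidegree n) (Sum.inr j))
  simpa [biforms, xyBidegree, MvPolynomial.mem_weightedHomogeneousSubmodule] using h

/-- The class of `xᵀ A y` modulo `I_{1,1}`. -/
def matrixForm {n : ℕ} (A : Matrix (Fin n) (Fin n) ℝ) : BilinModI n :=
  (orthIdealOneOne n).mkQ ⟨matrixPoly A, matrixPoly_mem A⟩

/-- `g` is symmetric if `g = xᵀ A y + I_{1,1}` for some symmetric matrix `A`. -/
def BilinModI.IsSymmetric {n : ℕ} (g : BilinModI n) : Prop :=
  ∃ A : Matrix (Fin n) (Fin n) ℝ, A.transpose = A ∧ g = matrixForm A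

/-- `g` is skew-symmetric if `g = xᵀ A y + I_{1,1}` for some skew-symmetric matrix `A`. -/
def BilinModI.IsSkewSymmetric {n : ℕ} (g : BilinModI n) : Prop :=
  ∃ A : Matrix (Fin n) (Fin n) ℝ, A.transpose = -A ∧ g = matrixForm A

/-! ### The Stiefel manifold and its invariant measure -/

/-- The Stiefel manifold `T = V_{2,n}(ℝ) = (𝕊ⁿ⁻¹ × 𝕊ⁿ⁻¹) ∩ V(I)` of pairs of orthonormal vectors
in `ℝⁿ`, with the subspace topology and its Borel `σ`-algebra. -/
abbrev StiefelTwo (n : ℕ) : Type :=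
  {w : (Fin n → ℝ) × (Fin n → ℝ) // w.1 ⬝ᵥ w.1 = 1 ∧ w.2 ⬝ᵥ w.2 = 1 ∧ w.2 ⬝ᵥ w.1 = 0}

/-- The special orthogonal group `SO(n)`. -/
abbrev SOReal (n : ℕ) : Type := Matrix.specialOrthogonalGroup (Fin n) ℝ

theorem SOReal.transpose_mul_self {n : ℕ} (U : SOReal n) :
    (U : Matrix (Fin n) (Fin n) ℝ).transpose * (U : Matrix (Fin n) (Fin n) ℝ) = 1 :=
  (Matrix.mem_orthogonalGroup_iff' (Fin n) ℝ).1
    (Matrix.mem_specialOrthogonalGroup_iff.1 U.2).1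

theorem SOReal.dotProduct_mulVec {n : ℕ} (U : SOReal n) (v w : Fin n → ℝ) :
    (U : Matrix (Fin n) (Fin n) ℝ).mulVec v ⬝ᵥ (U : Matrix (Fin n) (Fin n) ℝ).mulVec w
      = v ⬝ᵥ w := by
  rw [Matrix.dotProduct_mulVec, Matrix.vecMul_mulVec, ← Matrix.mulVec_transpose,
    Matrix.transpose_mul, Matrix.transpose_transpose, SOReal.transpose_mul_self,
    Matrix.one_mulVec]

/-- The action `U (x, y) = (U x, U y)` of `SO(n)` on `T`. -/
def stiefelRotate {n : ℕ} (U : SOReal n) (w : StiefelTwo n) : StiefelTwo n :=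
  ⟨((U : Matrix (Fin n) (Fin n) ℝ).mulVec w.1.1, (U : Matrix (Fin n) (Fin n) ℝ).mulVec w.1.2), by
    simpa only [SOReal.dotProduct_mulVec] using w.2⟩

instance SOReal.instIsTopologicalGroup (n : ℕ) : IsTopologicalGroup (SOReal n) where
  continuous_mul := continuous_mul
  continuous_inv :=
    Continuous.subtype_mk (continuous_star.comp continuous_subtype_val) _

instance SOReal.instCompactSpace (n : ℕ) : CompactSpace (SOReal n) := by
  have hc : IsCompact (X := Matrix (Fin n) (Fin n) ℝ) (Set.pi Set.univ fun _ : Fin n =>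
      Set.pi Set.univ fun _ : Fin n => Set.Icc (-1 : ℝ) 1) :=
    isCompact_univ_pi fun _ => isCompact_univ_pi fun _ => isCompact_Icc
  refine isCompact_iff_compactSpace.1 (hc.of_isClosed_subset
    (t := (Matrix.specialOrthogonalGroup (Fin n) ℝ : Set (Matrix (Fin n) (Fin n) ℝ))) ?_ ?_)
  · have h : ((Matrix.specialOrthogonalGroup (Fin n) ℝ : Submonoid (Matrix (Fin n) (Fin n) ℝ)) :
        Set (Matrix (Fin n) (Fin n) ℝ)) = {A | A * A.transpose = 1} ∩ {A | A.det = 1} := by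
      ext A
      simp only [SetLike.mem_coe, Matrix.mem_specialOrthogonalGroup_iff,
        Matrix.mem_orthogonalGroup_iff, Set.mem_inter_iff, Set.mem_ofPred_eq]
    rw [h]
    exact (isClosed_eq (continuous_id.matrix_mul continuous_id.matrix_transpose) continuous_const).inter
      (isClosed_eq continuous_id.matrix_det continuous_const)
  · intro A hA i _ j _
    have h := entry_norm_bound_of_unitary (𝕜 := ℝ)
      (Matrix.mem_specialOrthogonalGroup_iff.1 hA).1 i j
    exact abs_le.1 h

instance SOReal.instMeasurableSpace (n : ℕ) : MeasurableSpace (SOReal n) := borel _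

instance SOReal.instBorelSpace (n : ℕ) : BorelSpace (SOReal n) := ⟨rfl⟩

/-- The Haar measure on the compact group `SO(n)`, normalized to total mass `1`. -/
def haarSO (n : ℕ) : Measure (SOReal n) := Measure.haarMeasure ⊤

/-- The base point `(e₁, e₂)` of `T`. -/
def stiefelBase (n : ℕ) (h : 2 ≤ n) : StiefelTwo n :=
  ⟨(Pi.single ⟨0, by omega⟩ 1, Pi.single ⟨1, by omega⟩ 1), by simp⟩

/-- The `SO(n)`-invariant probability measure `σ` on `T`: the image of the normalized Haar measure
of `SO(n)` under `U ↦ U (e₁, e₂)`. (For `n < 2` the set `T` is empty.) -/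
def stiefelMeasure (n : ℕ) : Measure (StiefelTwo n) :=
  if h : 2 ≤ n then (haarSO n).map (fun U => stiefelRotate U (stiefelBase n h)) else 0

theorem continuous_stiefelRotate_left {n : ℕ} (w : StiefelTwo n) :
    Continuous fun U : SOReal n => stiefelRotate U w :=
  Continuous.subtype_mk ((continuous_subtype_val.matrix_mulVec continuous_const).prodMk
    (continuous_subtype_val.matrix_mulVec continuous_const)) _

theorem continuous_stiefelRotate_right {n : ℕ} (U : SOReal n) :
    Continuous fun w : StiefelTwo n => stiefelRotate U w :=
  Continuous.subtype_mk
    ((continuous_const.matrix_mulVec (continuous_fst.comp continuous_subtype_val)).prodMk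
      (continuous_const.matrix_mulVec (continuous_snd.comp continuous_subtype_val))) _

theorem isProbabilityMeasure_stiefelMeasure {n : ℕ} (h : 2 ≤ n) :
    IsProbabilityMeasure (stiefelMeasure n) := by
  have : IsProbabilityMeasure (haarSO n) :=
    ⟨by simpa [haarSO] using
      Measure.haarMeasure_self (K₀ := (⊤ : TopologicalSpace.PositiveCompacts (SOReal n)))⟩
  rw [stiefelMeasure, dif_pos h]
  exact Measure.isProbabilityMeasure_map
    (continuous_stiefelRotate_left _).measurable.aemeasurable

theorem map_stiefelRotate_stiefelMeasure {n : ℕ} (U : SOReal n) :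
    (stiefelMeasure n).map (stiefelRotate U) = stiefelMeasure n := by
  by_cases h : 2 ≤ n
  · have hU : Measurable fun V : SOReal n => U * V := (continuous_const.mul continuous_id).measurable
    have hm := (continuous_stiefelRotate_left (stiefelBase n h)).measurable
    have hinv : (haarSO n).map (fun V => U * V) = haarSO n := by
      rw [haarSO]
      exact map_mul_left_eq_self _ U
    rw [stiefelMeasure, dif_pos h,
      Measure.map_map (continuous_stiefelRotate_right U).measurable hm]
    conv_rhs => rw [← hinv, Measure.map_map hm hU]
    congr 1
    funext V
    simp [stiefelRotate, Function.comp, Matrix.mulVec_mulVec]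
  · simp [stiefelMeasure, h]

/-! ### Values and norms on the Stiefel manifold -/

/-- Evaluation of a bilinear biform at the points of `T`. -/
def biformEval (n : ℕ) : biforms n 1 1 →ₗ[ℝ] (StiefelTwo n → ℝ) where
  toFun p w := MvPolynomial.eval (Sum.elim w.1.1 w.1.2) (p : XYPoly n)
  map_add' p q := by funext w; simp
  map_smul' c p := by funext w; simp

theorem orthIdealOneOne_le_ker (n : ℕ) :
    orthIdealOneOne n ≤ LinearMap.ker (biformEval n) := by
  intro p hp
  have hp' : (p : XYPoly n) ∈ orthIdeal n := hp
  obtain ⟨q, hq⟩ := Ideal.mem_span_singleton'.1 hp'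
  rw [LinearMap.mem_ker]
  funext w
  have hw : ∑ i, w.1.1 i * w.1.2 i = 0 := by
    have := w.2.2.2
    rw [dotProduct_comm] at this
    exact this
  have h0 : MvPolynomial.eval (Sum.elim w.1.1 w.1.2) (orthPoly n) = 0 := by
    simpa [orthPoly] using hw
  change MvPolynomial.eval (Sum.elim w.1.1 w.1.2) (p : XYPoly n) = 0
  rw [← hq, map_mul, h0, mul_zero]

/-- The function on `T` defined by a bilinear form modulo `I`, namely `(x, y) ↦ g(x, y)`. -/
def BilinModI.onStiefel {n : ℕ} (g : BilinModI n) : StiefelTwo n → ℝ :=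
  (orthIdealOneOne n).liftQ (biformEval n) (orthIdealOneOne_le_ker n) g

/-- The norm `‖g‖_p = (∫_T |g|^p dσ)^{1/p}` of a bilinear form modulo `I`. -/
def BilinModI.stiefelNorm {n : ℕ} (g : BilinModI n) (p : ENNReal) : ℝ :=
  lpNorm g.onStiefel p (stiefelMeasure n)

end

/-!
Every form `g` agrees on `T` with `xᵀ A y` for a matrix `A` with `tr A = 0`, because the identity
matrix represents `yᵀ x = 0`. The integrals of `g ^ 2` and `g ^ 4` are means over `U ∈ SO(n)` of
powers of the `(1, 2)` entry of `Uᵀ A U`. They are found from two facts: Haar measure on the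
compact group `SO(n)` is invariant on the right, and `SO(n)` is transitive on orthonormal pairs
(`exists_stiefelRotate_base_eq`). So a mean of a function of `(U a, U b)` is the same for all
orthonormal pairs `(a, b)`. Comparing the pair `(e_i, e_j)` with its rotation by `45°`, and summing
over `i` and `j`, gives linear equations that determine the moments.

* Second moments (`haarMean_diag_sq`, `haarMean_offDiag_sq`): with `N = tr A Aᵀ`,
  `∫ (xᵀ A x)² = ((tr A)² + N + tr A²) / (n (n + 2))`, and hence
  `∫ (xᵀ A y)² = ((n + 1) N - (tr A)² - tr A²) / ((n - 1) n (n + 2))`.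
* Fourth moments (`haarMean_offDiag_pow_four`): integrating over `y` first,
  `∫ (xᵀ A y)⁴ = 3 / (n² - 1) * ∫ V²` with `V = |Aᵀ x|² - (xᵀ A x)²`.

Since `0 ≤ V ≤ |Aᵀ x|² = xᵀ (A Aᵀ) x`, the first formula applied to `A Aᵀ` bounds `∫ V²` by
`(N² + 2 tr (A Aᵀ)²) / (n (n + 2))`. For every `A` one has `tr (A Aᵀ)² ≤ N²`, and together with
`∫ g² ≥ N / ((n - 1) (n + 2))` for traceless `A` this gives `∫ g⁴ ≤ 9 (∫ g²)²`
(`haarMean_pow_four_le`). Thus the constant `√3` is valid for all forms, which contains both the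
general bound with `√6` and the symmetric case. For skew-symmetric `A` the nonzero singular values come
in pairs, so `tr (A Aᵀ)² ≤ N² / 2`, and `∫ g² = N / ((n - 1) n)`; this gives `∫ g⁴ ≤ 6 (∫ g²)²`
(`haarMean_pow_four_le_of_skew`).

The forms `x₁ y₁` and `x₁ y₂ - x₂ y₁` show that the constants are asymptotically sharp. For the
second one `V = x₁² + x₂²` and everything is exact. For the first one `V = x₁² - x₁⁴`, and the
bound `V² ≥ x₁⁴ - 2 x₁⁶` is sufficient.
-/

noncomputable section

/-! ### Orthonormal pairs and the averaging functional of `SO(n)` -/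

instance haarSO.instIsHaarMeasure (n : ℕ) : (haarSO n).IsHaarMeasure := by
  unfold haarSO
  infer_instance

instance haarSO.instIsProbabilityMeasure (n : ℕ) : IsProbabilityMeasure (haarSO n) :=
  ⟨by simpa [haarSO] using
    Measure.haarMeasure_self (K₀ := (⊤ : TopologicalSpace.PositiveCompacts (SOReal n)))⟩

/-- `SO(n)` is unimodular: right translates of Haar measure are Haar probability measures, and
those are unique on a compact group. -/
instance haarSO.instIsMulRightInvariant (n : ℕ) : (haarSO n).IsMulRightInvariant where
  map_mul_right_eq_self g := by
    have hm : Measurable fun V : SOReal n => V * g :=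
      (continuous_id.mul continuous_const).measurable
    have : IsProbabilityMeasure ((haarSO n).map (· * g)) :=
      Measure.isProbabilityMeasure_map hm.aemeasurable
    have : ((haarSO n).map (· * g)).IsHaarMeasure :=
      Measure.isHaarMeasure_map_mul_right _ g
    exact Measure.isHaarMeasure_eq_of_isProbabilityMeasure _ _

/-- `SO(n)` acts transitively on orthonormal pairs when `n ≥ 3`: complete the pair to an
orthonormal basis, and flip the sign of the third basis vector if the determinant is `-1`. -/
theorem exists_stiefelRotate_base_eq {n : ℕ} (hn : 3 ≤ n) (w : StiefelTwo n) :
    ∃ h : SOReal n, stiefelRotate h (stiefelBase n (by omega)) = w := by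
  obtain ⟨⟨a, b⟩, ha, hb, hba⟩ := w
  simp only at ha hb hba
  let i₀ : Fin n := ⟨0, by omega⟩
  let i₁ : Fin n := ⟨1, by omega⟩
  let i₂ : Fin n := ⟨2, by omega⟩
  have h01 : i₁ ≠ i₀ := by simp [i₀, i₁]
  have h02 : i₀ ≠ i₂ := by simp [i₀, i₂]
  have h12 : i₁ ≠ i₂ := by simp [i₁, i₂]
  let v : Fin n → EuclideanSpace ℝ (Fin n) := fun i => WithLp.toLp 2 (if i = i₀ then a else b)
  have hv : Orthonormal ℝ (({i₀, i₁} : Set (Fin n)).domRestrict v) := by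
    rw [orthonormal_iff_ite]
    rintro ⟨i, hi⟩ ⟨j, hj⟩
    have key : ∀ x y : Fin n → ℝ,
        inner ℝ (WithLp.toLp 2 x : EuclideanSpace ℝ (Fin n)) (WithLp.toLp 2 y) = y ⬝ᵥ x := by
      intro x y
      simp [EuclideanSpace.inner_eq_star_dotProduct]
    have hab : a ⬝ᵥ b = 0 := by rw [dotProduct_comm]; exact hba
    have hv0 : v i₀ = WithLp.toLp 2 a := by simp [v]
    have hv1 : v i₁ = WithLp.toLp 2 b := by simp [v, h01]
    change inner ℝ (v i) (v j) = _
    rcases hi with rfl | hi <;> rcases hj with rfl | hj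
    · rw [if_pos rfl, hv0, key, ha]
    · obtain rfl : j = i₁ := hj
      rw [if_neg (fun h => h01 (congrArg Subtype.val h).symm), hv0, hv1, key, hba]
    · obtain rfl : i = i₁ := hi
      rw [if_neg (fun h => h01 (congrArg Subtype.val h)), hv0, hv1, key, hab]
    · obtain rfl : i = i₁ := hi
      obtain rfl : j = i₁ := hj
      rw [if_pos rfl, hv1, key, hb]
  obtain ⟨B, hB⟩ := hv.exists_orthonormalBasis_extension_of_card_eq (by simp)
  let M : Matrix (Fin n) (Fin n) ℝ := Matrix.of fun i j => B j i
  have hM : M.transpose * M = 1 := by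
    ext i j
    have := B.inner_eq_ite j i
    simp only [EuclideanSpace.inner_eq_star_dotProduct] at this
    simp only [Matrix.mul_apply, Matrix.transpose_apply, M, Matrix.of_apply, Matrix.one_apply]
    simpa [dotProduct, eq_comm] using this
  have hdet : M.det * M.det = 1 := by
    have := congrArg Matrix.det hM
    simpa using this
  let D : Matrix (Fin n) (Fin n) ℝ := Matrix.diagonal fun i => if i = i₂ then M.det else 1
  have hDdet : D.det = M.det := by simp [D, Matrix.det_diagonal]
  have hD : D.transpose * D = 1 := by
    simp only [D, Matrix.diagonal_transpose, Matrix.diagonal_mul_diagonal]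
    rw [← Matrix.diagonal_one]
    congr 1
    funext i
    split_ifs <;> simp [hdet]
  have hU : M * D ∈ Matrix.specialOrthogonalGroup (Fin n) ℝ := by
    rw [Matrix.mem_specialOrthogonalGroup_iff, Matrix.mem_orthogonalGroup_iff']
    refine ⟨?_, by rw [Matrix.det_mul, hDdet, hdet]⟩
    change (M * D).transpose * (M * D) = 1
    rw [Matrix.transpose_mul, Matrix.mul_assoc, ← Matrix.mul_assoc M.transpose, hM,
      Matrix.one_mul, hD]
  refine ⟨⟨M * D, hU⟩, ?_⟩
  have hB0 : B i₀ = v i₀ := hB i₀ (by simp)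
  have hB1 : B i₁ = v i₁ := hB i₁ (by simp)
  apply Subtype.ext
  refine Prod.ext ?_ ?_
  · change (M * D).mulVec (Pi.single i₀ 1) = a
    ext i
    simp [D, M, hB0, v, h02]
  · change (M * D).mulVec (Pi.single i₁ 1) = b
    ext i
    simp [D, M, hB1, v, h01, h12]

/-- Integrals over `SO(n)` of a function of `(U a, U b)` do not depend on the orthonormal pair
`(a, b)`. -/
theorem integral_stiefelRotate_eq {n : ℕ} (hn : 3 ≤ n) (F : StiefelTwo n → ℝ)
    (w w' : StiefelTwo n) :
    ∫ U, F (stiefelRotate U w) ∂(haarSO n) = ∫ U, F (stiefelRotate U w') ∂(haarSO n) := by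
  have key : ∀ w : StiefelTwo n, ∫ U, F (stiefelRotate U w) ∂(haarSO n) =
      ∫ U, F (stiefelRotate U (stiefelBase n (by omega))) ∂(haarSO n) := by
    intro w
    obtain ⟨h, rfl⟩ := exists_stiefelRotate_base_eq hn w
    rw [← integral_mul_right_eq_self
      (fun U => F (stiefelRotate U (stiefelBase n (by omega)))) h]
    congr 1
    funext U
    simp [stiefelRotate, Matrix.mulVec_mulVec]
  rw [key w, key w']

/-- The mean value over `SO(n)` as a linear functional on continuous functions. -/
def haarMean (n : ℕ) : C(SOReal n, ℝ) →ₗ[ℝ] ℝ where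
  toFun f := ∫ U, f U ∂(haarSO n)
  map_add' f g := integral_add
    (f.continuous.integrable_of_hasCompactSupport (HasCompactSupport.of_compactSpace _))
    (g.continuous.integrable_of_hasCompactSupport (HasCompactSupport.of_compactSpace _))
  map_smul' c _ := integral_const_mul c _

theorem haarMean_mono {n : ℕ} {f g : C(SOReal n, ℝ)} (h : ∀ U, f U ≤ g U) :
    haarMean n f ≤ haarMean n g :=
  integral_mono
    (f.continuous.integrable_of_hasCompactSupport (HasCompactSupport.of_compactSpace _))
    (g.continuous.integrable_of_hasCompactSupport (HasCompactSupport.of_compactSpace _)) h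

theorem haarMean_const {n : ℕ} (c : ℝ) : haarMean n (ContinuousMap.const _ c) = c := by
  simp [haarMean]

/-- The function `U ↦ (U a)ᵀ A (U b)` on `SO(n)`. -/
def colForm {n : ℕ} (A : Matrix (Fin n) (Fin n) ℝ) (a b : Fin n → ℝ) : C(SOReal n, ℝ) where
  toFun U := (U : Matrix (Fin n) (Fin n) ℝ).mulVec a ⬝ᵥ
    A.mulVec ((U : Matrix (Fin n) (Fin n) ℝ).mulVec b)
  continuous_toFun := by
    have h : ∀ a : Fin n → ℝ, Continuous fun U : SOReal n =>
        (U : Matrix (Fin n) (Fin n) ℝ).mulVec a :=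
      fun a => continuous_subtype_val.matrix_mulVec continuous_const
    exact (h a).dotProduct (continuous_const.matrix_mulVec (h b))

/-- The entry `(Uᵀ A U) i j`, as a function of `U`. -/
def conjEntry {n : ℕ} (A : Matrix (Fin n) (Fin n) ℝ) (i j : Fin n) : C(SOReal n, ℝ) :=
  colForm A (Pi.single i 1) (Pi.single j 1)

theorem conjEntry_apply {n : ℕ} (A : Matrix (Fin n) (Fin n) ℝ) (i j : Fin n) (U : SOReal n) :
    conjEntry A i j U = ((U : Matrix (Fin n) (Fin n) ℝ).transpose * A *
      (U : Matrix (Fin n) (Fin n) ℝ)) i j := by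
  rw [conjEntry, colForm, ContinuousMap.coe_mk, Matrix.mulVec_single_one, Matrix.mulVec_single_one,
    Matrix.mul_assoc, Matrix.mul_apply']
  congr 1

/-- The normalized sum `(e_i + e_j) / √2`. -/
def halfSum {n : ℕ} (i j : Fin n) : Fin n → ℝ := (√2)⁻¹ • (Pi.single i 1 + Pi.single j 1)

/-- The normalized difference `(e_i - e_j) / √2`. -/
def halfDiff {n : ℕ} (i j : Fin n) : Fin n → ℝ := (√2)⁻¹ • (Pi.single i 1 - Pi.single j 1)

theorem inv_sqrt_two_mul_self : (√2)⁻¹ * (√2)⁻¹ = (1 / 2 : ℝ) := by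
  rw [← mul_inv, Real.mul_self_sqrt (by norm_num)]
  norm_num

theorem halfSum_dotProduct_self {n : ℕ} {i j : Fin n} (h : i ≠ j) :
    halfSum i j ⬝ᵥ halfSum i j = 1 := by
  simp only [halfSum, smul_dotProduct, dotProduct_smul, smul_eq_mul, ← mul_assoc,
    inv_sqrt_two_mul_self]
  simp [dotProduct_add, h, h.symm]
  norm_num

theorem halfDiff_dotProduct_self {n : ℕ} {i j : Fin n} (h : i ≠ j) :
    halfDiff i j ⬝ᵥ halfDiff i j = 1 := by
  simp only [halfDiff, smul_dotProduct, dotProduct_smul, smul_eq_mul, ← mul_assoc,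
    inv_sqrt_two_mul_self]
  simp [dotProduct_sub, h, h.symm]
  norm_num

theorem halfDiff_dotProduct_halfSum {n : ℕ} {i j : Fin n} (h : i ≠ j) :
    halfDiff i j ⬝ᵥ halfSum i j = 0 := by
  simp only [halfDiff, halfSum, smul_dotProduct, dotProduct_smul, smul_eq_mul]
  simp [dotProduct_add, h, h.symm]

/-- Invariance of means under a change of orthonormal pair, for functions built from the two
columns `U a` and `U b`. -/
theorem haarMean_eq_of_orthonormal {n : ℕ} (hn : 3 ≤ n) (F : (Fin n → ℝ) → (Fin n → ℝ) → ℝ)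
    {a b a' b' : Fin n → ℝ} (ha : a ⬝ᵥ a = 1) (hb : b ⬝ᵥ b = 1) (hab : b ⬝ᵥ a = 0)
    (ha' : a' ⬝ᵥ a' = 1) (hb' : b' ⬝ᵥ b' = 1) (hab' : b' ⬝ᵥ a' = 0)
    {f g : C(SOReal n, ℝ)}
    (hf : ∀ U : SOReal n, f U = F ((U : Matrix (Fin n) (Fin n) ℝ).mulVec a)
      ((U : Matrix (Fin n) (Fin n) ℝ).mulVec b))
    (hg : ∀ U : SOReal n, g U = F ((U : Matrix (Fin n) (Fin n) ℝ).mulVec a')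
      ((U : Matrix (Fin n) (Fin n) ℝ).mulVec b')) :
    haarMean n f = haarMean n g := by
  have h := integral_stiefelRotate_eq hn (fun w => F w.1.1 w.1.2) ⟨(a, b), ha, hb, hab⟩
    ⟨(a', b'), ha', hb', hab'⟩
  simp only [stiefelRotate, ← hf, ← hg] at h
  exact h

theorem single_dotProduct_single_of_ne {n : ℕ} {i j : Fin n} (h : i ≠ j) :
    (Pi.single j 1 : Fin n → ℝ) ⬝ᵥ Pi.single i 1 = 0 := by
  simp [h.symm]

theorem single_dotProduct_single_self {n : ℕ} (i : Fin n) :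
    (Pi.single i 1 : Fin n → ℝ) ⬝ᵥ Pi.single i 1 = 1 := by
  simp

/-! ### Second moments of the entries of `Uᵀ A U` -/

theorem colForm_inv_sqrt_two_smul {n : ℕ} (A : Matrix (Fin n) (Fin n) ℝ) (a b : Fin n → ℝ) :
    colForm A ((√2)⁻¹ • a) ((√2)⁻¹ • b) = (1 / 2 : ℝ) • colForm A a b := by
  ext U
  simp only [colForm, Matrix.mulVec_smul, smul_dotProduct, dotProduct_smul, ContinuousMap.coe_mk,
    ContinuousMap.smul_apply, smul_eq_mul, ← mul_assoc, inv_sqrt_two_mul_self]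

theorem colForm_halfSum_halfDiff {n : ℕ} (A : Matrix (Fin n) (Fin n) ℝ) (i j : Fin n) :
    colForm A (halfSum i j) (halfDiff i j) =
      (1 / 2 : ℝ) • (conjEntry A i i - conjEntry A i j + conjEntry A j i - conjEntry A j j) := by
  rw [halfSum, halfDiff, colForm_inv_sqrt_two_smul]
  congr 1
  ext U
  simp only [colForm, conjEntry, Matrix.mulVec_add, Matrix.mulVec_sub, add_dotProduct,
    dotProduct_sub, ContinuousMap.coe_mk, ContinuousMap.add_apply, ContinuousMap.sub_apply]
  ring

theorem colForm_halfDiff_halfSum {n : ℕ} (A : Matrix (Fin n) (Fin n) ℝ) (i j : Fin n) :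
    colForm A (halfDiff i j) (halfSum i j) =
      (1 / 2 : ℝ) • (conjEntry A i i + conjEntry A i j - conjEntry A j i - conjEntry A j j) := by
  rw [halfSum, halfDiff, colForm_inv_sqrt_two_smul]
  congr 1
  ext U
  simp only [colForm, conjEntry, Matrix.mulVec_add, Matrix.mulVec_sub, sub_dotProduct,
    dotProduct_add, ContinuousMap.coe_mk, ContinuousMap.add_apply, ContinuousMap.sub_apply]
  ring

theorem SOReal.mul_transpose_self {n : ℕ} (U : SOReal n) :
    (U : Matrix (Fin n) (Fin n) ℝ) * (U : Matrix (Fin n) (Fin n) ℝ).transpose = 1 :=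
  mul_eq_one_comm.1 U.transpose_mul_self

theorem conj_mul_conj {n : ℕ} (U : SOReal n) (A B : Matrix (Fin n) (Fin n) ℝ) :
    (U : Matrix (Fin n) (Fin n) ℝ).transpose * A * (U : Matrix (Fin n) (Fin n) ℝ) *
      ((U : Matrix (Fin n) (Fin n) ℝ).transpose * B * (U : Matrix (Fin n) (Fin n) ℝ)) =
    (U : Matrix (Fin n) (Fin n) ℝ).transpose * (A * B) * (U : Matrix (Fin n) (Fin n) ℝ) := by
  calc _ = (U : Matrix (Fin n) (Fin n) ℝ).transpose * A * ((U : Matrix (Fin n) (Fin n) ℝ) *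
      (U : Matrix (Fin n) (Fin n) ℝ).transpose) * B * (U : Matrix (Fin n) (Fin n) ℝ) := by
        simp only [Matrix.mul_assoc]
    _ = _ := by rw [SOReal.mul_transpose_self, Matrix.mul_one]; simp only [Matrix.mul_assoc]

theorem trace_conj {n : ℕ} (U : SOReal n) (A : Matrix (Fin n) (Fin n) ℝ) :
    ((U : Matrix (Fin n) (Fin n) ℝ).transpose * A * (U : Matrix (Fin n) (Fin n) ℝ)).trace =
      A.trace := by
  rw [Matrix.trace_mul_comm, ← Matrix.mul_assoc, SOReal.mul_transpose_self, Matrix.one_mul]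

theorem conjEntry_transpose {n : ℕ} (A : Matrix (Fin n) (Fin n) ℝ) (i j : Fin n) :
    conjEntry A.transpose i j = conjEntry A j i := by
  ext U
  rw [conjEntry_apply, conjEntry_apply, ← Matrix.transpose_apply (_ * A * _)]
  simp only [Matrix.transpose_mul, Matrix.transpose_transpose, Matrix.mul_assoc]

theorem sum_conjEntry_mul_conjEntry {n : ℕ} (A B : Matrix (Fin n) (Fin n) ℝ) (i k : Fin n) :
    ∑ j, conjEntry A i j * conjEntry B j k = conjEntry (A * B) i k := by
  ext U
  simp only [ContinuousMap.sum_apply, ContinuousMap.mul_apply, conjEntry_apply]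
  rw [← conj_mul_conj, Matrix.mul_apply]

theorem sum_conjEntry_self {n : ℕ} (A : Matrix (Fin n) (Fin n) ℝ) :
    ∑ i, conjEntry A i i = ContinuousMap.const _ A.trace := by
  ext U
  simp only [ContinuousMap.sum_apply, conjEntry_apply, ContinuousMap.const_apply]
  rw [← trace_conj U A, Matrix.trace]
  rfl

theorem haarMean_sum_conjEntry_self {n : ℕ} (A : Matrix (Fin n) (Fin n) ℝ) :
    ∑ i, haarMean n (conjEntry A i i) = A.trace := by
  rw [← map_sum, sum_conjEntry_self, haarMean_const]

theorem sum_sum_eq_of_diag {ι : Type*} [DecidableEq ι] (s : Finset ι) (f : ι → ι → ℝ) {d e : ℝ}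
    (hd : ∀ i ∈ s, f i i = d) (he : ∀ i ∈ s, ∀ j ∈ s, i ≠ j → f i j = e) :
    ∑ i ∈ s, ∑ j ∈ s, f i j = s.card * d + s.card * (s.card - 1) * e := by
  have h : ∀ i ∈ s, ∑ j ∈ s, f i j = d + (s.card - 1) * e := by
    intro i hi
    rw [← Finset.add_sum_erase s _ hi, hd i hi, Finset.sum_congr rfl fun j hj =>
      he i hi j (Finset.mem_of_mem_erase hj) (Finset.ne_of_mem_erase hj).symm, Finset.sum_const,
      Finset.card_erase_of_mem hi, nsmul_eq_mul,
      Nat.cast_sub (Finset.card_pos.2 ⟨i, hi⟩), Nat.cast_one]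
  rw [Finset.sum_congr rfl h, Finset.sum_const, nsmul_eq_mul]
  ring

theorem haarMean_eq_single {n : ℕ} (hn : 3 ≤ n) (F : (Fin n → ℝ) → (Fin n → ℝ) → ℝ)
    {i j k l : Fin n} (hij : i ≠ j) (hkl : k ≠ l) {f g : C(SOReal n, ℝ)}
    (hf : ∀ U : SOReal n, f U = F ((U : Matrix (Fin n) (Fin n) ℝ).mulVec (Pi.single i 1))
      ((U : Matrix (Fin n) (Fin n) ℝ).mulVec (Pi.single j 1)))
    (hg : ∀ U : SOReal n, g U = F ((U : Matrix (Fin n) (Fin n) ℝ).mulVec (Pi.single k 1))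
      ((U : Matrix (Fin n) (Fin n) ℝ).mulVec (Pi.single l 1))) :
    haarMean n f = haarMean n g :=
  haarMean_eq_of_orthonormal hn F (single_dotProduct_single_self i)
    (single_dotProduct_single_self j) (single_dotProduct_single_of_ne hij)
    (single_dotProduct_single_self k) (single_dotProduct_single_self l)
    (single_dotProduct_single_of_ne hkl) hf hg

theorem exists_ne_of_three_le {n : ℕ} (hn : 3 ≤ n) (i : Fin n) : ∃ j, i ≠ j := by
  have : Nontrivial (Fin n) := Fin.nontrivial_iff_two_le.2 (by omega)
  obtain ⟨j, hj⟩ := exists_ne i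
  exact ⟨j, hj.symm⟩

/-- Functions of the single column `U e_i` have a mean that does not depend on `i`. -/
theorem haarMean_eq_single_left {n : ℕ} (hn : 3 ≤ n) (F : (Fin n → ℝ) → ℝ)
    (i k : Fin n) {f g : C(SOReal n, ℝ)}
    (hf : ∀ U : SOReal n, f U = F ((U : Matrix (Fin n) (Fin n) ℝ).mulVec (Pi.single i 1)))
    (hg : ∀ U : SOReal n, g U = F ((U : Matrix (Fin n) (Fin n) ℝ).mulVec (Pi.single k 1))) :
    haarMean n f = haarMean n g := by
  obtain ⟨j, hj⟩ := exists_ne_of_three_le hn i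
  obtain ⟨l, hl⟩ := exists_ne_of_three_le hn k
  exact haarMean_eq_single hn (fun x _ => F x) hj hl hf hg

/-- The relation between second moments that comes from rotating the `(i, j)`-plane by `45°`.
Both orders of the rotated pair are used, so that the mixed terms cancel. -/
theorem haarMean_rotation_relation {n : ℕ} (hn : 3 ≤ n) (A : Matrix (Fin n) (Fin n) ℝ)
    {i j : Fin n} (hij : i ≠ j) :
    haarMean n (conjEntry A i j ^ 2) + haarMean n (conjEntry A i j * conjEntry A j i) =
      haarMean n (conjEntry A i i ^ 2) - haarMean n (conjEntry A i i * conjEntry A j j) := by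
  have h1 : haarMean n (colForm A (halfSum i j) (halfDiff i j) ^ 2) =
      haarMean n (conjEntry A i j ^ 2) :=
    haarMean_eq_of_orthonormal hn (fun x y => (x ⬝ᵥ A.mulVec y) ^ 2)
      (halfSum_dotProduct_self hij) (halfDiff_dotProduct_self hij)
      (halfDiff_dotProduct_halfSum hij) (single_dotProduct_single_self i)
      (single_dotProduct_single_self j) (single_dotProduct_single_of_ne hij)
      (fun U => rfl) (fun U => rfl)
  have h2 : haarMean n (colForm A (halfDiff i j) (halfSum i j) ^ 2) =
      haarMean n (conjEntry A i j ^ 2) :=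
    haarMean_eq_of_orthonormal hn (fun x y => (x ⬝ᵥ A.mulVec y) ^ 2)
      (halfDiff_dotProduct_self hij) (halfSum_dotProduct_self hij)
      (by rw [dotProduct_comm]; exact halfDiff_dotProduct_halfSum hij)
      (single_dotProduct_single_self i) (single_dotProduct_single_self j)
      (single_dotProduct_single_of_ne hij) (fun U => rfl) (fun U => rfl)
  have h3 : haarMean n (conjEntry A j i ^ 2) = haarMean n (conjEntry A i j ^ 2) :=
    haarMean_eq_single hn (fun x y => (x ⬝ᵥ A.mulVec y) ^ 2) hij.symm hij
      (fun U => rfl) (fun U => rfl)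
  have h4 : haarMean n (conjEntry A j j ^ 2) = haarMean n (conjEntry A i i ^ 2) :=
    haarMean_eq_single_left hn (fun x => (x ⬝ᵥ A.mulVec x) ^ 2) j i
      (fun U => rfl) (fun U => rfl)
  have h5 : colForm A (halfSum i j) (halfDiff i j) ^ 2 + colForm A (halfDiff i j) (halfSum i j) ^ 2
      = (1 / 2 : ℝ) • (conjEntry A i i ^ 2 + conjEntry A j j ^ 2 + conjEntry A i j ^ 2 +
        conjEntry A j i ^ 2 - (2 : ℝ) • (conjEntry A i i * conjEntry A j j) -
        (2 : ℝ) • (conjEntry A i j * conjEntry A j i)) := by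
    rw [colForm_halfSum_halfDiff, colForm_halfDiff_halfSum]
    ext U
    simp
    ring
  have h6 := congrArg (haarMean n) h5
  simp only [map_add, map_sub, map_smul, smul_eq_mul, h1, h2, h3, h4] at h6
  linarith

/-- The sum of the mean squares of all entries of `Uᵀ A U` is the squared Frobenius norm. -/
theorem haarMean_sum_sq {n : ℕ} (hn : 3 ≤ n) (A : Matrix (Fin n) (Fin n) ℝ)
    {i j : Fin n} (hij : i ≠ j) :
    n * haarMean n (conjEntry A i i ^ 2) + n * (n - 1) * haarMean n (conjEntry A i j ^ 2) =
      (A * A.transpose).trace := by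
  have h := sum_sum_eq_of_diag Finset.univ (fun k l => haarMean n (conjEntry A k l ^ 2))
    (fun k _ => haarMean_eq_single_left hn (fun x => (x ⬝ᵥ A.mulVec x) ^ 2) k i
      (g := conjEntry A i i ^ 2) (fun U => rfl) (fun U => rfl))
    (fun k _ l _ hkl => haarMean_eq_single hn (fun x y => (x ⬝ᵥ A.mulVec y) ^ 2) hkl hij
      (g := conjEntry A i j ^ 2) (fun U => rfl) (fun U => rfl))
  simp only [Finset.card_univ, Fintype.card_fin] at h
  rw [← h, ← haarMean_sum_conjEntry_self]
  refine Finset.sum_congr rfl fun k _ => ?_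
  rw [← map_sum, ← sum_conjEntry_mul_conjEntry]
  congr 1
  refine Finset.sum_congr rfl fun l _ => ?_
  rw [conjEntry_transpose, sq]

theorem haarMean_sum_mul_swap {n : ℕ} (hn : 3 ≤ n) (A : Matrix (Fin n) (Fin n) ℝ)
    {i j : Fin n} (hij : i ≠ j) :
    n * haarMean n (conjEntry A i i ^ 2) +
      n * (n - 1) * haarMean n (conjEntry A i j * conjEntry A j i) = (A * A).trace := by
  have h := sum_sum_eq_of_diag Finset.univ
    (fun k l => haarMean n (conjEntry A k l * conjEntry A l k))
    (fun k _ => haarMean_eq_single_left hn (fun x => (x ⬝ᵥ A.mulVec x) ^ 2) k i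
      (g := conjEntry A i i ^ 2) (fun U => (sq _).symm) (fun U => rfl))
    (fun k _ l _ hkl => haarMean_eq_single hn
      (fun x y => (x ⬝ᵥ A.mulVec y) * (y ⬝ᵥ A.mulVec x)) hkl hij
      (g := conjEntry A i j * conjEntry A j i) (fun U => rfl) (fun U => rfl))
  simp only [Finset.card_univ, Fintype.card_fin] at h
  rw [← h, ← haarMean_sum_conjEntry_self]
  refine Finset.sum_congr rfl fun k _ => ?_
  rw [← map_sum, ← sum_conjEntry_mul_conjEntry]

theorem haarMean_sum_diag_mul_diag {n : ℕ} (hn : 3 ≤ n) (A : Matrix (Fin n) (Fin n) ℝ)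
    {i j : Fin n} (hij : i ≠ j) :
    n * haarMean n (conjEntry A i i ^ 2) +
      n * (n - 1) * haarMean n (conjEntry A i i * conjEntry A j j) = A.trace ^ 2 := by
  have h := sum_sum_eq_of_diag Finset.univ
    (fun k l => haarMean n (conjEntry A k k * conjEntry A l l))
    (fun k _ => haarMean_eq_single_left hn (fun x => (x ⬝ᵥ A.mulVec x) ^ 2) k i
      (g := conjEntry A i i ^ 2) (fun U => (sq _).symm) (fun U => rfl))
    (fun k _ l _ hkl => haarMean_eq_single hn
      (fun x y => (x ⬝ᵥ A.mulVec x) * (y ⬝ᵥ A.mulVec y)) hkl hij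
      (g := conjEntry A i i * conjEntry A j j) (fun U => rfl) (fun U => rfl))
  simp only [Finset.card_univ, Fintype.card_fin] at h
  rw [← h]
  simp only [← map_sum, ← Finset.mul_sum, ← Finset.sum_mul, sum_conjEntry_self]
  rw [← haarMean_const (n := n) (A.trace ^ 2)]
  congr 1
  ext U
  simp [sq]

/-- `∫ (xᵀ A x)² = ((tr A)² + tr A Aᵀ + tr A²) / (n (n + 2))` for `x` uniform on the sphere. -/
theorem haarMean_diag_sq {n : ℕ} (hn : 3 ≤ n) (A : Matrix (Fin n) (Fin n) ℝ) (i : Fin n) :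
    haarMean n (conjEntry A i i ^ 2) =
      (A.trace ^ 2 + (A * A.transpose).trace + (A * A).trace) / (n * (n + 2)) := by
  obtain ⟨j, hij⟩ := exists_ne_of_three_le hn i
  have h1 := haarMean_sum_sq hn A hij
  have h2 := haarMean_sum_mul_swap hn A hij
  have h3 := haarMean_sum_diag_mul_diag hn A hij
  have h4 := haarMean_rotation_relation hn A hij
  have hn' : (3 : ℝ) ≤ n := by exact_mod_cast hn
  rw [eq_div_iff (by positivity)]
  linear_combination h1 + h2 + h3 - n * (n - 1) * h4

/-- `∫ (xᵀ A y)²` for an orthonormal pair `(x, y)`. -/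
theorem haarMean_offDiag_sq {n : ℕ} (hn : 3 ≤ n) (A : Matrix (Fin n) (Fin n) ℝ) {i j : Fin n}
    (hij : i ≠ j) :
    haarMean n (conjEntry A i j ^ 2) =
      ((n + 1) * (A * A.transpose).trace - A.trace ^ 2 - (A * A).trace) /
        ((n - 1) * n * (n + 2)) := by
  have h1 := haarMean_sum_sq hn A hij
  rw [haarMean_diag_sq hn] at h1
  have hn' : (3 : ℝ) ≤ n := by exact_mod_cast hn
  have hn1 : (n : ℝ) - 1 ≠ 0 := by linarith
  field_simp at h1 ⊢
  linear_combination h1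

/-! ### Fourth moments of the entries of `Uᵀ A U` -/

theorem colForm_single_halfSum {n : ℕ} (A : Matrix (Fin n) (Fin n) ℝ) (k i j : Fin n) :
    colForm A (Pi.single k 1) (halfSum i j) = (√2)⁻¹ • (conjEntry A k i + conjEntry A k j) := by
  ext U
  simp [colForm, conjEntry, halfSum, Matrix.mulVec_smul, Matrix.mulVec_add, dotProduct_add]

theorem colForm_single_halfDiff {n : ℕ} (A : Matrix (Fin n) (Fin n) ℝ) (k i j : Fin n) :
    colForm A (Pi.single k 1) (halfDiff i j) = (√2)⁻¹ • (conjEntry A k i - conjEntry A k j) := by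
  ext U
  simp [colForm, conjEntry, halfDiff, Matrix.mulVec_smul, Matrix.mulVec_sub, dotProduct_sub]

/-- Given `x`, the vector `y` is uniform on the unit sphere of the orthogonal complement of `x`, so
mixed fourth moments of its coordinates are a third of the pure ones. -/
theorem haarMean_sq_mul_sq {n : ℕ} (hn : 3 ≤ n) (A : Matrix (Fin n) (Fin n) ℝ) {k i j : Fin n}
    (hki : k ≠ i) (hkj : k ≠ j) (hij : i ≠ j) :
    haarMean n (conjEntry A k i ^ 2 * conjEntry A k j ^ 2) =
      haarMean n (conjEntry A k i ^ 4) / 3 := by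
  have orth : ∀ v : Fin n → ℝ, v k = 0 → v ⬝ᵥ Pi.single k 1 = 0 := by
    intro v hv
    simp [hv]
  have h1 : haarMean n (colForm A (Pi.single k 1) (halfSum i j) ^ 4) =
      haarMean n (conjEntry A k i ^ 4) :=
    haarMean_eq_of_orthonormal hn (fun x y => (x ⬝ᵥ A.mulVec y) ^ 4)
      (single_dotProduct_single_self k) (halfSum_dotProduct_self hij)
      (orth _ (by simp [halfSum, hki, hkj]))
      (single_dotProduct_single_self k) (single_dotProduct_single_self i)
      (single_dotProduct_single_of_ne hki) (fun U => rfl) (fun U => rfl)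
  have h2 : haarMean n (colForm A (Pi.single k 1) (halfDiff i j) ^ 4) =
      haarMean n (conjEntry A k i ^ 4) :=
    haarMean_eq_of_orthonormal hn (fun x y => (x ⬝ᵥ A.mulVec y) ^ 4)
      (single_dotProduct_single_self k) (halfDiff_dotProduct_self hij)
      (orth _ (by simp [halfDiff, hki, hkj]))
      (single_dotProduct_single_self k) (single_dotProduct_single_self i)
      (single_dotProduct_single_of_ne hki) (fun U => rfl) (fun U => rfl)
  have h3 : haarMean n (conjEntry A k j ^ 4) = haarMean n (conjEntry A k i ^ 4) :=
    haarMean_eq_single hn (fun x y => (x ⬝ᵥ A.mulVec y) ^ 4) hkj hki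
      (fun U => rfl) (fun U => rfl)
  have h4 : colForm A (Pi.single k 1) (halfSum i j) ^ 4 +
      colForm A (Pi.single k 1) (halfDiff i j) ^ 4 =
      (1 / 2 : ℝ) • (conjEntry A k i ^ 4 + (6 : ℝ) • (conjEntry A k i ^ 2 * conjEntry A k j ^ 2) +
        conjEntry A k j ^ 4) := by
    rw [colForm_single_halfSum, colForm_single_halfDiff]
    ext U
    have h : ((√2)⁻¹) ^ 4 = (1 / 4 : ℝ) := by
      linear_combination ((√2)⁻¹ * (√2)⁻¹ + 1 / 2) * inv_sqrt_two_mul_self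
    simp only [ContinuousMap.add_apply, ContinuousMap.pow_apply, ContinuousMap.smul_apply,
      ContinuousMap.sub_apply, ContinuousMap.mul_apply, smul_eq_mul, mul_pow, h]
    ring
  have h5 := congrArg (haarMean n) h4
  simp only [map_add, map_smul, smul_eq_mul, h1, h2, h3] at h5
  linarith

/-- The squared length `|Aᵀ x|² - (xᵀ A x)²` of the projection of `Aᵀ x` to the orthogonal
complement of `x = U e_k`. -/
def projSq {n : ℕ} (A : Matrix (Fin n) (Fin n) ℝ) (k : Fin n) : C(SOReal n, ℝ) :=
  conjEntry (A * A.transpose) k k - conjEntry A k k ^ 2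

theorem projSq_eq_sum {n : ℕ} (A : Matrix (Fin n) (Fin n) ℝ) (k : Fin n) :
    projSq A k = ∑ i ∈ Finset.univ.erase k, conjEntry A k i ^ 2 := by
  rw [projSq, sub_eq_iff_eq_add, Finset.sum_erase_add _ _ (Finset.mem_univ k),
    ← sum_conjEntry_mul_conjEntry]
  refine Finset.sum_congr rfl fun l _ => ?_
  rw [conjEntry_transpose, sq]

/-- `(n² - 1) ∫ (xᵀ A y)⁴ = 3 ∫ (|Aᵀ x|² - (xᵀ A x)²)²`: integrate over `y` first. -/
theorem haarMean_offDiag_pow_four {n : ℕ} (hn : 3 ≤ n) (A : Matrix (Fin n) (Fin n) ℝ)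
    {k i : Fin n} (hki : k ≠ i) :
    haarMean n (conjEntry A k i ^ 4) =
      3 / ((n - 1) * (n + 1)) * haarMean n (projSq A k ^ 2) := by
  have h := sum_sum_eq_of_diag (Finset.univ.erase k)
    (fun a b => haarMean n (conjEntry A k a ^ 2 * conjEntry A k b ^ 2))
    (d := haarMean n (conjEntry A k i ^ 4)) (e := haarMean n (conjEntry A k i ^ 4) / 3)
    (fun a ha => by
      rw [← pow_add]
      exact haarMean_eq_single hn (fun x y => (x ⬝ᵥ A.mulVec y) ^ 4)
        (Finset.ne_of_mem_erase ha).symm hki (fun U => rfl) (fun U => rfl))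
    (fun a ha b hb hab => by
      rw [haarMean_sq_mul_sq hn A (Finset.ne_of_mem_erase ha).symm
        (Finset.ne_of_mem_erase hb).symm hab]
      congr 1
      exact haarMean_eq_single hn (fun x y => (x ⬝ᵥ A.mulVec y) ^ 4)
        (Finset.ne_of_mem_erase ha).symm hki (fun U => rfl) (fun U => rfl))
  simp only [← map_sum, ← Finset.mul_sum, ← Finset.sum_mul] at h
  rw [← projSq_eq_sum, ← sq, Finset.card_erase_of_mem (Finset.mem_univ k), Finset.card_univ,
    Fintype.card_fin, Nat.cast_sub (by omega), Nat.cast_one] at h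
  have hn' : (3 : ℝ) ≤ n := by exact_mod_cast hn
  have hn1 : (n : ℝ) - 1 ≠ 0 := by linarith
  rw [h]
  field_simp
  ring

theorem projSq_nonneg {n : ℕ} (A : Matrix (Fin n) (Fin n) ℝ) (k : Fin n) (U : SOReal n) :
    0 ≤ projSq A k U := by
  rw [projSq_eq_sum, ContinuousMap.sum_apply]
  exact Finset.sum_nonneg fun i _ => by simpa using sq_nonneg _

theorem haarMean_projSq_sq_le {n : ℕ} (hn : 3 ≤ n) (A : Matrix (Fin n) (Fin n) ℝ) (k : Fin n) :
    haarMean n (projSq A k ^ 2) ≤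
      ((A * A.transpose).trace ^ 2 + 2 * (A * A.transpose * (A * A.transpose)).trace) /
        (n * (n + 2)) := by
  have h := haarMean_diag_sq hn (A * A.transpose) k
  have ht : (A * A.transpose).transpose = A * A.transpose := by
    rw [Matrix.transpose_mul, Matrix.transpose_transpose]
  rw [ht, add_assoc, ← two_mul] at h
  rw [← h]
  refine haarMean_mono fun U => ?_
  have h1 := projSq_nonneg A k U
  have h2 : projSq A k U ≤ conjEntry (A * A.transpose) k k U := by
    simp only [projSq, ContinuousMap.sub_apply, ContinuousMap.pow_apply]
    linarith [sq_nonneg (conjEntry A k k U)]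
  simp only [ContinuousMap.pow_apply]
  gcongr

/-! ### Frobenius norm estimates -/

theorem trace_mul_transpose {n : ℕ} (A B : Matrix (Fin n) (Fin n) ℝ) :
    (A * B.transpose).trace = ∑ i, ∑ j, A i j * B i j := by
  simp [Matrix.trace, Matrix.mul_apply]

theorem trace_mul_transpose_nonneg {n : ℕ} (A : Matrix (Fin n) (Fin n) ℝ) :
    0 ≤ (A * A.transpose).trace := by
  rw [trace_mul_transpose]
  exact Finset.sum_nonneg fun i _ => Finset.sum_nonneg fun j _ => mul_self_nonneg _

theorem trace_sq_le_trace_mul_transpose {n : ℕ} (A : Matrix (Fin n) (Fin n) ℝ) :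
    (A * A).trace ≤ (A * A.transpose).trace := by
  have h : (A * A).trace = ∑ i, ∑ j, A i j * A j i := by
    simp [Matrix.trace, Matrix.mul_apply]
  have h2 : (A * A.transpose).trace = ∑ i, ∑ j, A j i * A j i := by
    rw [trace_mul_transpose, Finset.sum_comm]
  have h3 : 0 ≤ ∑ i, ∑ j, (A i j - A j i) ^ 2 :=
    Finset.sum_nonneg fun i _ => Finset.sum_nonneg fun j _ => sq_nonneg _
  have h4 : ∑ i, ∑ j, (A i j - A j i) ^ 2 =
      ∑ i, ∑ j, A i j * A i j + ∑ i, ∑ j, A j i * A j i - 2 * ∑ i, ∑ j, A i j * A j i := by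
    simp only [Finset.mul_sum, ← Finset.sum_add_distrib, ← Finset.sum_sub_distrib]
    exact Finset.sum_congr rfl fun i _ => Finset.sum_congr rfl fun j _ => by ring
  rw [← trace_mul_transpose, ← h, ← h2] at h4
  linarith

/-- Bounds on `|A v|²` relative to the Frobenius norm of `A` pass to `tr (A Aᵀ)²`. -/
theorem trace_mul_transpose_sq_le {n : ℕ} (A : Matrix (Fin n) (Fin n) ℝ) (c : ℝ)
    (hc : ∀ v, A.mulVec v ⬝ᵥ A.mulVec v ≤ c * (A * A.transpose).trace * (v ⬝ᵥ v)) :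
    (A * A.transpose * (A * A.transpose)).trace ≤ c * (A * A.transpose).trace ^ 2 := by
  have h1 : (A * A.transpose * (A * A.transpose)).trace =
      ∑ i, A.mulVec (A i) ⬝ᵥ A.mulVec (A i) := by
    have ht : (A * A.transpose).transpose = A * A.transpose := by
      rw [Matrix.transpose_mul, Matrix.transpose_transpose]
    nth_rewrite 2 [← ht]
    rw [trace_mul_transpose, Finset.sum_comm]
    rfl
  have h2 : (A * A.transpose).trace = ∑ i, A i ⬝ᵥ A i := trace_mul_transpose A A
  calc _ = ∑ i, A.mulVec (A i) ⬝ᵥ A.mulVec (A i) := h1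
    _ ≤ ∑ i, c * (A * A.transpose).trace * (A i ⬝ᵥ A i) := Finset.sum_le_sum fun i _ => hc _
    _ = _ := by rw [← Finset.mul_sum, ← h2]; ring

theorem mulVec_dotProduct_mulVec_le {n : ℕ} (A : Matrix (Fin n) (Fin n) ℝ) (v : Fin n → ℝ) :
    A.mulVec v ⬝ᵥ A.mulVec v ≤ (A * A.transpose).trace * (v ⬝ᵥ v) := by
  rw [trace_mul_transpose, Finset.sum_mul]
  refine Finset.sum_le_sum fun i _ => ?_
  have := Finset.sum_mul_sq_le_sq_mul_sq Finset.univ (A i) v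
  simpa [Matrix.mulVec, dotProduct, sq] using this

/-- A skew-symmetric matrix satisfies `|A v|² ≤ ½ ‖A‖² |v|²` for the Frobenius norm: with
`w = A v ⟂ v`, expand `0 ≤ ‖|v|² A - (w vᵀ - v wᵀ)‖²`. -/
theorem mulVec_dotProduct_mulVec_le_of_skew {n : ℕ} {A : Matrix (Fin n) (Fin n) ℝ}
    (hA : A.transpose = -A) (v : Fin n → ℝ) :
    A.mulVec v ⬝ᵥ A.mulVec v ≤ 1 / 2 * (A * A.transpose).trace * (v ⬝ᵥ v) := by
  set w := A.mulVec v with hw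
  have hskew : ∀ i j, A j i = -A i j := fun i j => by
    have := congrFun (congrFun hA i) j
    simpa using this
  have hwA : ∀ j, ∑ i, w i * A i j = -A.mulVec w j := by
    intro j
    simp only [Matrix.mulVec, dotProduct, ← Finset.sum_neg_distrib]
    exact Finset.sum_congr rfl fun i _ => by rw [hskew i j]; ring
  have hvw : v ⬝ᵥ w = 0 := by
    have h : v ⬝ᵥ A.mulVec v = -(v ⬝ᵥ A.mulVec v) := by
      conv_lhs => rw [Matrix.dotProduct_mulVec, ← Matrix.mulVec_transpose, hA, Matrix.neg_mulVec,
        neg_dotProduct, dotProduct_comm]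
    linarith
  set N := (A * A.transpose).trace
  set s := v ⬝ᵥ v
  set t := w ⬝ᵥ w
  have e1 : ∑ i, ∑ j, A i j * A i j = N := (trace_mul_transpose A A).symm
  have e2 : ∑ i, ∑ j, A i j * (w i * v j) = t := by
    simp only [t, dotProduct]
    refine Finset.sum_congr rfl fun i _ => ?_
    conv_rhs => enter [2]; rw [hw]
    simp only [Matrix.mulVec, dotProduct, Finset.mul_sum]
    exact Finset.sum_congr rfl fun j _ => by ring
  have e3 : ∑ i, ∑ j, A i j * (v i * w j) = -t := by
    rw [← e2, Finset.sum_comm, ← Finset.sum_neg_distrib]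
    refine Finset.sum_congr rfl fun i _ => ?_
    rw [← Finset.sum_neg_distrib]
    exact Finset.sum_congr rfl fun j _ => by rw [hskew i j]; ring
  have e4 : ∑ i, ∑ j, (w i * w i) * (v j * v j) = t * s := by
    rw [← Finset.sum_mul_sum]; rfl
  have e5 : ∑ i, ∑ j, (v i * v i) * (w j * w j) = s * t := by
    rw [← Finset.sum_mul_sum]; rfl
  have e6 : ∑ i, ∑ j, (v i * w i) * (v j * w j) = 0 := by
    have : ∑ i, v i * w i = 0 := hvw
    rw [← Finset.sum_mul_sum, this, zero_mul]
  have h0 : 0 ≤ ∑ i, ∑ j, (s * A i j - (w i * v j - v i * w j)) ^ 2 :=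
    Finset.sum_nonneg fun i _ => Finset.sum_nonneg fun j _ => sq_nonneg _
  have h1 : ∑ i, ∑ j, (s * A i j - (w i * v j - v i * w j)) ^ 2 =
      s ^ 2 * ∑ i, ∑ j, A i j * A i j - 2 * s * ∑ i, ∑ j, A i j * (w i * v j) +
      2 * s * ∑ i, ∑ j, A i j * (v i * w j) + ∑ i, ∑ j, (w i * w i) * (v j * v j) +
      ∑ i, ∑ j, (v i * v i) * (w j * w j) - 2 * ∑ i, ∑ j, (v i * w i) * (v j * w j) := by
    simp only [Finset.mul_sum, ← Finset.sum_add_distrib, ← Finset.sum_sub_distrib]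
    exact Finset.sum_congr rfl fun i _ => Finset.sum_congr rfl fun j _ => by ring
  rw [h1, e1, e2, e3, e4, e5, e6] at h0
  have hs : 0 ≤ s := dotProduct_self_star_nonneg v
  rcases hs.eq_or_lt with hs | hs
  · have hv : v = 0 := dotProduct_self_eq_zero.1 hs.symm
    have ht : t = 0 := by simp [t, hw, hv]
    rw [ht, ← hs]
    simp
  · have : 0 ≤ s * (s * N - 2 * t) := by linarith
    have := nonneg_of_mul_nonneg_right this hs
    linarith

/-! ### Fourth moment against second moment -/

theorem haarMean_pow_four_le {n : ℕ} (hn : 3 ≤ n) {A : Matrix (Fin n) (Fin n) ℝ}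
    (hA : A.trace = 0) {k i : Fin n} (hki : k ≠ i) :
    haarMean n (conjEntry A k i ^ 4) ≤ 9 * haarMean n (conjEntry A k i ^ 2) ^ 2 := by
  have hn' : (3 : ℝ) ≤ n := by exact_mod_cast hn
  have hn1 : (0 : ℝ) < n - 1 := by linarith
  set N := (A * A.transpose).trace with hN
  have hN0 : 0 ≤ N := trace_mul_transpose_nonneg A
  have hq : N / ((n - 1) * (n + 2)) ≤ haarMean n (conjEntry A k i ^ 2) := by
    rw [haarMean_offDiag_sq hn A hki, hA, div_le_div_iff₀ (by positivity) (by positivity)]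
    have h := trace_sq_le_trace_mul_transpose A
    rw [← hN] at h ⊢
    have : 0 ≤ (N - (A * A).trace) * ((n - 1) * (n + 2)) :=
      mul_nonneg (by linarith) (by positivity)
    nlinarith
  have hW : haarMean n (projSq A k ^ 2) ≤ 3 * N ^ 2 / (n * (n + 2)) := by
    refine (haarMean_projSq_sq_le hn A k).trans ?_
    gcongr
    have := trace_mul_transpose_sq_le A 1 (fun v => by
      rw [one_mul]; exact mulVec_dotProduct_mulVec_le A v)
    linarith
  calc haarMean n (conjEntry A k i ^ 4)
      = 3 / ((n - 1) * (n + 1)) * haarMean n (projSq A k ^ 2) :=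
        haarMean_offDiag_pow_four hn A hki
    _ ≤ 3 / ((n - 1) * (n + 1)) * (3 * N ^ 2 / (n * (n + 2))) := by gcongr
    _ = 9 * N ^ 2 * (1 / ((n - 1) * (n + 2) * (n * (n + 1)))) := by field_simp; ring
    _ ≤ 9 * N ^ 2 * (1 / ((n - 1) * (n + 2) * ((n - 1) * (n + 2)))) := by
        -- `(n - 1) (n + 2) = n (n + 1) - 2`
        gcongr 9 * N ^ 2 * (1 / (_ * ?_))
        linarith
    _ = 9 * (N / ((n - 1) * (n + 2))) ^ 2 := by field_simp
    _ ≤ _ := by gcongr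

theorem trace_eq_zero_of_skew {n : ℕ} {A : Matrix (Fin n) (Fin n) ℝ} (hA : A.transpose = -A) :
    A.trace = 0 := by
  have h := congrArg Matrix.trace hA
  rw [Matrix.trace_transpose, Matrix.trace_neg] at h
  linarith

theorem haarMean_offDiag_sq_of_skew {n : ℕ} (hn : 3 ≤ n) {A : Matrix (Fin n) (Fin n) ℝ}
    (hA : A.transpose = -A) {k i : Fin n} (hki : k ≠ i) :
    haarMean n (conjEntry A k i ^ 2) = (A * A.transpose).trace / ((n - 1) * n) := by
  have hn' : (3 : ℝ) ≤ n := by exact_mod_cast hn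
  have hn1 : (n : ℝ) - 1 ≠ 0 := by linarith
  have h : (A * A).trace = -(A * A.transpose).trace := by
    rw [hA, Matrix.mul_neg, Matrix.trace_neg, neg_neg]
  rw [haarMean_offDiag_sq hn A hki, trace_eq_zero_of_skew hA, h]
  field_simp
  ring

theorem haarMean_pow_four_le_of_skew {n : ℕ} (hn : 3 ≤ n) {A : Matrix (Fin n) (Fin n) ℝ}
    (hA : A.transpose = -A) {k i : Fin n} (hki : k ≠ i) :
    haarMean n (conjEntry A k i ^ 4) ≤ 6 * haarMean n (conjEntry A k i ^ 2) ^ 2 := by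
  have hn' : (3 : ℝ) ≤ n := by exact_mod_cast hn
  have hn1 : (0 : ℝ) < n - 1 := by linarith
  rw [haarMean_offDiag_sq_of_skew hn hA hki]
  set N := (A * A.transpose).trace with hN
  have hW : haarMean n (projSq A k ^ 2) ≤ 2 * N ^ 2 / (n * (n + 2)) := by
    refine (haarMean_projSq_sq_le hn A k).trans ?_
    gcongr
    have := trace_mul_transpose_sq_le A (1 / 2) (mulVec_dotProduct_mulVec_le_of_skew hA)
    linarith
  calc haarMean n (conjEntry A k i ^ 4)
      = 3 / ((n - 1) * (n + 1)) * haarMean n (projSq A k ^ 2) :=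
        haarMean_offDiag_pow_four hn A hki
    _ ≤ 3 / ((n - 1) * (n + 1)) * (2 * N ^ 2 / (n * (n + 2))) := by gcongr
    _ = 6 * N ^ 2 * (1 / ((n - 1) * n * ((n + 1) * (n + 2)))) := by field_simp; ring
    _ ≤ 6 * N ^ 2 * (1 / ((n - 1) * n * ((n - 1) * n))) := by
        gcongr 6 * N ^ 2 * (1 / (_ * ?_))
        nlinarith
    _ = 6 * (N / ((n - 1) * n)) ^ 2 := by field_simp

/-! ### Extremal forms -/

/-- The coordinate `(U a)_k`, as a function of `U`. -/
def colCoord {n : ℕ} (k : Fin n) (a : Fin n → ℝ) : C(SOReal n, ℝ) where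
  toFun U := (U : Matrix (Fin n) (Fin n) ℝ).mulVec a k
  continuous_toFun := (continuous_apply k).comp
    (continuous_subtype_val.matrix_mulVec continuous_const)

theorem dotProduct_single_mulVec {n : ℕ} (k l : Fin n) (c : ℝ) (x y : Fin n → ℝ) :
    x ⬝ᵥ (Matrix.single k l c).mulVec y = c * (x k * y l) := by
  rw [Matrix.single_mulVec]
  change x ⬝ᵥ Pi.single k (c * y l) = _
  rw [dotProduct_single]
  ring

theorem conjEntry_single {n : ℕ} (k l i j : Fin n) :
    conjEntry (Matrix.single k l 1) i j =
      colCoord k (Pi.single i 1) * colCoord l (Pi.single j 1) := by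
  ext U
  simp only [conjEntry, colForm, colCoord, ContinuousMap.coe_mk, dotProduct_single_mulVec, one_mul,
    ContinuousMap.mul_apply]

theorem haarMean_colCoord_pow_four {n : ℕ} (hn : 3 ≤ n) (k i : Fin n) :
    haarMean n (colCoord k (Pi.single i 1) ^ 4) = 3 / (n * (n + 2)) := by
  have h := haarMean_diag_sq hn (Matrix.single k k 1) i
  rw [conjEntry_single, ← sq, ← pow_mul] at h
  rw [h]
  simp
  norm_num

theorem sum_colCoord_sq {n : ℕ} (k : Fin n) :
    ∑ i, colCoord k (Pi.single i 1) ^ 2 = 1 := by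
  ext U
  have h := congrFun (congrFun (SOReal.mul_transpose_self U) k) k
  simpa [Matrix.mul_apply, colCoord, sq] using h

/-- `∫ x_k⁶ = 15 / (n (n + 2) (n + 4))` on the unit sphere. -/
theorem haarMean_colCoord_pow_six {n : ℕ} (hn : 3 ≤ n) (k i : Fin n) :
    haarMean n (colCoord k (Pi.single i 1) ^ 6) = 15 / (n * (n + 2) * (n + 4)) := by
  have mixed : ∀ j, i ≠ j → haarMean n
      (colCoord k (Pi.single i 1) ^ 4 * colCoord k (Pi.single j 1) ^ 2) =
      haarMean n (colCoord k (Pi.single i 1) ^ 6) / 5 := by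
    intro j hij
    have h1 : haarMean n (colCoord k (halfSum i j) ^ 6) =
        haarMean n (colCoord k (Pi.single i 1) ^ 6) :=
      haarMean_eq_of_orthonormal hn (fun x _ => x k ^ 6)
        (halfSum_dotProduct_self hij) (halfDiff_dotProduct_self hij)
        (halfDiff_dotProduct_halfSum hij) (single_dotProduct_single_self i)
        (single_dotProduct_single_self j) (single_dotProduct_single_of_ne hij)
        (fun U => rfl) (fun U => rfl)
    have h2 : haarMean n (colCoord k (halfDiff i j) ^ 6) =
        haarMean n (colCoord k (Pi.single i 1) ^ 6) :=
      haarMean_eq_of_orthonormal hn (fun x _ => x k ^ 6)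
        (halfDiff_dotProduct_self hij) (halfSum_dotProduct_self hij)
        (by rw [dotProduct_comm]; exact halfDiff_dotProduct_halfSum hij)
        (single_dotProduct_single_self i) (single_dotProduct_single_self j)
        (single_dotProduct_single_of_ne hij) (fun U => rfl) (fun U => rfl)
    have h3 : haarMean n (colCoord k (Pi.single j 1) ^ 6) =
        haarMean n (colCoord k (Pi.single i 1) ^ 6) :=
      haarMean_eq_single_left hn (fun x => x k ^ 6) j i (fun U => rfl) (fun U => rfl)
    have h4 : haarMean n (colCoord k (Pi.single j 1) ^ 4 * colCoord k (Pi.single i 1) ^ 2) =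
        haarMean n (colCoord k (Pi.single i 1) ^ 4 * colCoord k (Pi.single j 1) ^ 2) :=
      haarMean_eq_single hn (fun x y => x k ^ 4 * y k ^ 2) hij.symm hij
        (fun U => rfl) (fun U => rfl)
    have h5 : colCoord k (halfSum i j) ^ 6 + colCoord k (halfDiff i j) ^ 6 =
        (1 / 4 : ℝ) • (colCoord k (Pi.single i 1) ^ 6 + colCoord k (Pi.single j 1) ^ 6 +
          (15 : ℝ) • (colCoord k (Pi.single i 1) ^ 4 * colCoord k (Pi.single j 1) ^ 2) +
          (15 : ℝ) • (colCoord k (Pi.single j 1) ^ 4 * colCoord k (Pi.single i 1) ^ 2)) := by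
      have h : ((√2)⁻¹) ^ 6 = (1 / 8 : ℝ) := by
        calc ((√2)⁻¹) ^ 6 = ((√2)⁻¹ * (√2)⁻¹) ^ 3 := by ring
          _ = 1 / 8 := by rw [inv_sqrt_two_mul_self]; norm_num
      ext U
      simp only [colCoord, halfSum, halfDiff, Matrix.mulVec_smul, Matrix.mulVec_add,
        Matrix.mulVec_sub, ContinuousMap.add_apply, ContinuousMap.pow_apply,
        ContinuousMap.mul_apply, ContinuousMap.smul_apply, ContinuousMap.coe_mk, Pi.smul_apply,
        Pi.add_apply, Pi.sub_apply, smul_eq_mul, mul_pow, h]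
      ring
    have h6 := congrArg (haarMean n) h5
    simp only [map_add, map_smul, smul_eq_mul, h1, h2, h3, h4] at h6
    linarith
  have h := haarMean_colCoord_pow_four hn k i
  rw [← mul_one (colCoord k (Pi.single i 1) ^ 4), ← sum_colCoord_sq k, Finset.mul_sum,
    map_sum, ← Finset.add_sum_erase _ _ (Finset.mem_univ i), ← pow_add,
    Finset.sum_congr rfl fun j hj => mixed j (Finset.ne_of_mem_erase hj).symm,
    Finset.sum_const, Finset.card_erase_of_mem (Finset.mem_univ i), Finset.card_univ,
    Fintype.card_fin, nsmul_eq_mul, Nat.cast_sub (by omega), Nat.cast_one] at h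
  have hn' : (3 : ℝ) ≤ n := by exact_mod_cast hn
  rw [eq_div_iff (by positivity)] at h ⊢
  linear_combination 5 * h

theorem haarMean_single_sq {n : ℕ} (hn : 3 ≤ n) (m : Fin n) {k i : Fin n} (hki : k ≠ i) :
    haarMean n (conjEntry (Matrix.single m m 1) k i ^ 2) = 1 / (n * (n + 2)) := by
  have hn' : (3 : ℝ) ≤ n := by exact_mod_cast hn
  have hn1 : (n : ℝ) - 1 ≠ 0 := by linarith
  rw [haarMean_offDiag_sq hn _ hki]
  simp
  field_simp

/-- The fourth moment of `x_m y_m` is asymptotically nine times the square of its second moment.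
The bound drops the term `x_m⁸ ≥ 0` of `(x_m² - x_m⁴)²`. -/
theorem le_haarMean_single_pow_four {n : ℕ} (hn : 3 ≤ n) (m : Fin n) {k i : Fin n}
    (hki : k ≠ i) :
    9 * ((n / (n - 1)) * ((n + 2) / (n + 1)) * ((n - 6) / (n + 4))) *
      haarMean n (conjEntry (Matrix.single m m 1) k i ^ 2) ^ 2 ≤
      haarMean n (conjEntry (Matrix.single m m 1) k i ^ 4) := by
  have hn' : (3 : ℝ) ≤ n := by exact_mod_cast hn
  have hn1 : (0 : ℝ) < n - 1 := by linarith
  have hW : 3 / (n * (n + 2)) - 2 * (15 / (n * (n + 2) * (n + 4))) ≤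
      haarMean n (projSq (Matrix.single m m 1) k ^ 2) := by
    rw [← haarMean_colCoord_pow_four hn m k, ← haarMean_colCoord_pow_six hn m k, ← smul_eq_mul,
      ← map_smul, ← map_sub]
    refine haarMean_mono fun U => ?_
    simp only [projSq, Matrix.transpose_single, Matrix.single_mul_single_same, mul_one,
      conjEntry_single, ContinuousMap.sub_apply, ContinuousMap.smul_apply,
      ContinuousMap.pow_apply, ContinuousMap.mul_apply, smul_eq_mul]
    nlinarith [sq_nonneg (colCoord m (Pi.single k 1) U ^ 4)]
  rw [haarMean_single_sq hn m hki, haarMean_offDiag_pow_four hn _ hki]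
  refine le_trans (le_of_eq ?_) (mul_le_mul_of_nonneg_left hW (by positivity))
  field_simp
  ring

theorem skewUnit_transpose {n : ℕ} (k l : Fin n) :
    (Matrix.single k l (1 : ℝ) - Matrix.single l k 1).transpose =
      -(Matrix.single k l (1 : ℝ) - Matrix.single l k 1) := by
  simp [Matrix.transpose_single]

theorem skewUnit_mul_transpose {n : ℕ} {k l : Fin n} (h : k ≠ l) :
    (Matrix.single k l (1 : ℝ) - Matrix.single l k 1) *
      (Matrix.single k l (1 : ℝ) - Matrix.single l k 1).transpose =
      Matrix.single k k 1 + Matrix.single l l 1 := by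
  simp [Matrix.transpose_single, mul_sub, sub_mul, h, h.symm]

theorem haarMean_skewUnit_sq {n : ℕ} (hn : 3 ≤ n) {a b k i : Fin n} (hab : a ≠ b)
    (hki : k ≠ i) :
    haarMean n (conjEntry (Matrix.single a b 1 - Matrix.single b a 1) k i ^ 2) =
      2 / ((n - 1) * n) := by
  rw [haarMean_offDiag_sq_of_skew hn (skewUnit_transpose a b) hki, skewUnit_mul_transpose hab]
  simp
  norm_num

theorem haarMean_skewUnit_pow_four {n : ℕ} (hn : 3 ≤ n) {a b k i : Fin n} (hab : a ≠ b)
    (hki : k ≠ i) :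
    haarMean n (conjEntry (Matrix.single a b 1 - Matrix.single b a 1) k i ^ 4) =
      6 * ((n - 1) / (n + 1) * (n / (n + 2))) *
        haarMean n (conjEntry (Matrix.single a b 1 - Matrix.single b a 1) k i ^ 2) ^ 2 := by
  have hn' : (3 : ℝ) ≤ n := by exact_mod_cast hn
  have hn1 : (n : ℝ) - 1 ≠ 0 := by linarith
  rw [haarMean_skewUnit_sq hn hab hki, haarMean_offDiag_pow_four hn _ hki]
  set A : Matrix (Fin n) (Fin n) ℝ := Matrix.single a b 1 - Matrix.single b a 1 with hA
  have h0 : conjEntry A k k = 0 := by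
    have h : conjEntry A k k = -conjEntry A k k := by
      conv_lhs => rw [← conjEntry_transpose, hA, skewUnit_transpose, ← hA]
      ext U
      simp [conjEntry, colForm, Matrix.neg_mulVec]
    ext U
    have hU := congrArg (fun f : C(SOReal n, ℝ) => f U) h
    simp only [ContinuousMap.neg_apply] at hU
    simpa using self_eq_neg.1 hU
  have h1 : projSq A k = conjEntry (Matrix.single a a 1 + Matrix.single b b 1) k k := by
    rw [projSq, h0, hA, skewUnit_mul_transpose hab]
    simp
  have h2 := haarMean_diag_sq hn (Matrix.single a a 1 + Matrix.single b b 1) k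
  rw [h1, h2]
  simp [Matrix.transpose_single, mul_add, add_mul, hab, hab.symm]
  field_simp
  ring

/-! ### Bilinear forms as functions on the Stiefel manifold -/

theorem BilinModI.onStiefel_matrixForm {n : ℕ} (A : Matrix (Fin n) (Fin n) ℝ)
    (w : StiefelTwo n) : (matrixForm A).onStiefel w = w.1.1 ⬝ᵥ A.mulVec w.1.2 := by
  change MvPolynomial.eval (Sum.elim w.1.1 w.1.2) (matrixPoly A) = _
  simp only [matrixPoly, map_sum, map_mul, MvPolynomial.eval_C, MvPolynomial.eval_X,
    Sum.elim_inl, Sum.elim_inr, dotProduct, Matrix.mulVec, Finset.mul_sum]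
  exact Finset.sum_congr rfl fun i _ => Finset.sum_congr rfl fun j _ => by ring

theorem Finset.prod_pow_eq_of_sum_eq_one {ι R : Type*} [Fintype ι] [CommMonoid R] {d : ι → ℕ}
    (h : ∑ i, d i = 1) : ∃ i, ∀ x : ι → R, ∏ j, x j ^ d j = x i := by
  obtain ⟨i, hi⟩ := (Finsupp.sum_eq_one_iff (Finsupp.equivFunOnFinite.symm d)).1 (by
    rwa [Finsupp.sum_fintype _ _ fun _ => rfl])
  have hd : ∀ j, d j = Finsupp.single i 1 j := fun j => by rw [← hi]; rfl
  refine ⟨i, fun x => ?_⟩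
  rw [Finset.prod_eq_single i]
  · simp [hd]
  · intro j _ hji
    simp [hd, hji]
  · simp

/-- A biform of bidegree `(1, 1)` has values `xᵀ A y` for some matrix `A`. -/
theorem exists_matrix_eval_eq {n : ℕ} (p : biforms n 1 1) :
    ∃ A : Matrix (Fin n) (Fin n) ℝ, ∀ x y : Fin n → ℝ,
      MvPolynomial.eval (Sum.elim x y) (p : XYPoly n) = x ⬝ᵥ A.mulVec y := by
  have hmon : ∀ d ∈ (p : XYPoly n).support, ∃ A : Matrix (Fin n) (Fin n) ℝ,
      ∀ x y : Fin n → ℝ, MvPolynomial.coeff d (p : XYPoly n) *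
        ∏ i, (Sum.elim x y) i ^ d i = x ⬝ᵥ A.mulVec y := by
    intro d hd
    have hw : Finsupp.weight (xyBidegree n) d = (1, 1) := p.2 (MvPolynomial.mem_support_iff.1 hd)
    rw [Finsupp.weight_apply, Finsupp.sum_fintype _ _ (by simp)] at hw
    simp only [Fintype.sum_sum_type, xyBidegree, Sum.elim_inl, Sum.elim_inr] at hw
    have h1 : ∑ i, d (Sum.inl i) = 1 := by
      simpa [Prod.fst_sum] using congrArg Prod.fst hw
    have h2 : ∑ i, d (Sum.inr i) = 1 := by
      simpa [Prod.snd_sum] using congrArg Prod.snd hw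
    obtain ⟨i, hi⟩ := Finset.prod_pow_eq_of_sum_eq_one (R := ℝ) h1
    obtain ⟨j, hj⟩ := Finset.prod_pow_eq_of_sum_eq_one (R := ℝ) h2
    refine ⟨Matrix.single i j (MvPolynomial.coeff d (p : XYPoly n)), fun x y => ?_⟩
    simp only [Fintype.prod_sum_type, Sum.elim_inl, Sum.elim_inr, hi, hj]
    exact (dotProduct_single_mulVec i j _ x y).symm
  choose! A hA using hmon
  refine ⟨∑ d ∈ (p : XYPoly n).support, A d, fun x y => ?_⟩
  rw [MvPolynomial.eval_eq', Matrix.sum_mulVec, dotProduct_sum]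
  exact Finset.sum_congr rfl fun d hd => hA d hd x y

/-- On `T` the identity matrix represents `yᵀ x = 0`, so the representing matrix of a form may be
taken traceless. -/
theorem BilinModI.exists_traceless {n : ℕ} (hn : n ≠ 0) (g : BilinModI n) :
    ∃ A : Matrix (Fin n) (Fin n) ℝ, A.trace = 0 ∧
      ∀ w, g.onStiefel w = w.1.1 ⬝ᵥ A.mulVec w.1.2 := by
  obtain ⟨p, rfl⟩ := Submodule.mkQ_surjective _ g
  obtain ⟨A, hA⟩ := exists_matrix_eval_eq p
  refine ⟨A - (A.trace / n) • 1, ?_, fun w => ?_⟩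
  · have : (n : ℝ) ≠ 0 := by exact_mod_cast hn
    simp [this]
  · have h0 : w.1.1 ⬝ᵥ w.1.2 = 0 := by rw [dotProduct_comm]; exact w.2.2.2
    rw [Matrix.sub_mulVec, dotProduct_sub, Matrix.smul_mulVec, Matrix.one_mulVec,
      dotProduct_smul, h0, smul_zero, sub_zero, ← hA]
    rfl

theorem BilinModI.continuous_onStiefel {n : ℕ} (g : BilinModI n) : Continuous g.onStiefel := by
  obtain ⟨p, rfl⟩ := Submodule.mkQ_surjective _ g
  obtain ⟨A, hA⟩ := exists_matrix_eval_eq p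
  have h : BilinModI.onStiefel ((orthIdealOneOne n).mkQ p) = fun w => w.1.1 ⬝ᵥ A.mulVec w.1.2 :=
    funext fun w => hA _ _
  rw [h]
  exact (continuous_fst.comp continuous_subtype_val).dotProduct
    (continuous_const.matrix_mulVec (continuous_snd.comp continuous_subtype_val))

theorem BilinModI.integral_pow {n : ℕ} (hn : 2 ≤ n) (g : BilinModI n)
    {A : Matrix (Fin n) (Fin n) ℝ} (hA : ∀ w, g.onStiefel w = w.1.1 ⬝ᵥ A.mulVec w.1.2) (m : ℕ) :
    ∫ w, g.onStiefel w ^ m ∂(stiefelMeasure n) =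
      haarMean n (conjEntry A ⟨0, by omega⟩ ⟨1, by omega⟩ ^ m) := by
  rw [stiefelMeasure, dif_pos hn, integral_map
    (f := fun w => g.onStiefel w ^ m) (continuous_stiefelRotate_left _).measurable.aemeasurable
    (g.continuous_onStiefel.pow m).aestronglyMeasurable]
  simp only [hA]
  rfl

theorem BilinModI.stiefelNorm_four {n : ℕ} (g : BilinModI n) :
    g.stiefelNorm 4 = (∫ w, g.onStiefel w ^ 4 ∂(stiefelMeasure n)) ^ (1 / 4 : ℝ) := by
  rw [BilinModI.stiefelNorm, lpNorm_eq_integral_norm_rpow_toReal (by norm_num) (by norm_num)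
    g.continuous_onStiefel.aestronglyMeasurable]
  have h : (4 : ENNReal).toReal = (4 : ℕ) := by norm_num
  simp only [h, Real.rpow_natCast, Real.norm_eq_abs, Even.pow_abs (by decide : Even 4)]
  norm_num

theorem BilinModI.stiefelNorm_two {n : ℕ} (g : BilinModI n) :
    g.stiefelNorm 2 = (∫ w, g.onStiefel w ^ 2 ∂(stiefelMeasure n)) ^ (1 / 2 : ℝ) := by
  rw [BilinModI.stiefelNorm, lpNorm_eq_integral_norm_rpow_toReal (by norm_num) (by norm_num)
    g.continuous_onStiefel.aestronglyMeasurable]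
  have h : (2 : ENNReal).toReal = (2 : ℕ) := by norm_num
  simp only [h, Real.rpow_natCast, Real.norm_eq_abs, sq_abs]
  norm_num

theorem BilinModI.integral_pow_even_nonneg {n m : ℕ} (hm : Even m) (g : BilinModI n) :
    0 ≤ ∫ w, g.onStiefel w ^ m ∂(stiefelMeasure n) :=
  integral_nonneg fun _ => hm.pow_nonneg _

theorem rpow_quarter_sq {a : ℝ} (ha : 0 ≤ a) : (a ^ 2) ^ (1 / 4 : ℝ) = a ^ (1 / 2 : ℝ) := by
  rw [← Real.rpow_natCast, ← Real.rpow_mul ha]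
  norm_num

theorem rpow_quarter_nine : (9 : ℝ) ^ (1 / 4 : ℝ) = √3 := by
  rw [Real.sqrt_eq_rpow, ← rpow_quarter_sq (by norm_num)]
  norm_num

/-- A bound `∫ g⁴ ≤ c (∫ g²)²` as an inequality of norms. -/
theorem BilinModI.stiefelNorm_four_le {n : ℕ} (g : BilinModI n) {c : ℝ} (hc : 0 ≤ c)
    (h : ∫ w, g.onStiefel w ^ 4 ∂(stiefelMeasure n) ≤
      c * (∫ w, g.onStiefel w ^ 2 ∂(stiefelMeasure n)) ^ 2) :
    g.stiefelNorm 4 ≤ c ^ (1 / 4 : ℝ) * g.stiefelNorm 2 := by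
  have h2 := g.integral_pow_even_nonneg even_two
  rw [g.stiefelNorm_four, g.stiefelNorm_two, ← rpow_quarter_sq h2, ← Real.mul_rpow hc (sq_nonneg _)]
  exact Real.rpow_le_rpow (g.integral_pow_even_nonneg (by decide)) h (by norm_num)

theorem BilinModI.stiefelNorm_div {n : ℕ} (g : BilinModI n) :
    g.stiefelNorm 4 / g.stiefelNorm 2 =
      ((∫ w, g.onStiefel w ^ 4 ∂(stiefelMeasure n)) /
        (∫ w, g.onStiefel w ^ 2 ∂(stiefelMeasure n)) ^ 2) ^ (1 / 4 : ℝ) := by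
  rw [Real.div_rpow (g.integral_pow_even_nonneg (by decide)) (sq_nonneg _),
    rpow_quarter_sq (g.integral_pow_even_nonneg even_two), g.stiefelNorm_four, g.stiefelNorm_two]

theorem BilinModI.integral_pow_four_le {n : ℕ} (hn : 3 ≤ n) (g : BilinModI n) :
    ∫ w, g.onStiefel w ^ 4 ∂(stiefelMeasure n) ≤
      9 * (∫ w, g.onStiefel w ^ 2 ∂(stiefelMeasure n)) ^ 2 := by
  obtain ⟨A, hA, hg⟩ := g.exists_traceless (by omega)
  rw [g.integral_pow (by omega) hg, g.integral_pow (by omega) hg]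
  exact haarMean_pow_four_le hn hA (by simp)

theorem BilinModI.stiefelNorm_four_le_sqrt_three {n : ℕ} (hn : 3 ≤ n) (g : BilinModI n) :
    g.stiefelNorm 4 ≤ √3 * g.stiefelNorm 2 := by
  rw [← rpow_quarter_nine]
  exact g.stiefelNorm_four_le (by norm_num) (g.integral_pow_four_le hn)

/-! ### Asymptotic sharpness -/

theorem tendsto_natCast_add_div_natCast_add (a b : ℝ) :
    Filter.Tendsto (fun n : ℕ => ((n : ℝ) + a) / (n + b)) Filter.atTop (nhds 1) := by
  have h := tendsto_add_mul_div_add_mul_atTop_nhds (𝕜 := ℝ) a b 1 one_ne_zero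
  simpa [add_comm] using h

theorem BilinModI.stiefelNorm_two_pos {n : ℕ} (g : BilinModI n)
    (h : 0 < ∫ w, g.onStiefel w ^ 2 ∂(stiefelMeasure n)) : 0 < g.stiefelNorm 2 := by
  rw [g.stiefelNorm_two]
  exact Real.rpow_pos_of_pos h _

/-- The constant `√3` is asymptotically attained by the form `x₁ y₁`. -/
theorem exists_symmetric_tendsto :
    ∃ g : (n : ℕ) → BilinModI n,
      (∀ n : ℕ, 3 ≤ n → (g n).IsSymmetric ∧ 0 < (g n).stiefelNorm 2) ∧
      Filter.Tendsto (fun n : ℕ => (g n).stiefelNorm 4 / (g n).stiefelNorm 2)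
        Filter.atTop (nhds (Real.sqrt 3)) := by
  let A : (n : ℕ) → Matrix (Fin n) (Fin n) ℝ := fun n =>
    if h : 3 ≤ n then Matrix.single ⟨0, by omega⟩ ⟨0, by omega⟩ 1 else 0
  have hA : ∀ {n : ℕ} (hn : 3 ≤ n), A n = Matrix.single ⟨0, by omega⟩ ⟨0, by omega⟩ 1 :=
    fun hn => dif_pos hn
  have hint : ∀ {n : ℕ} (hn : 3 ≤ n) (m : ℕ),
      ∫ w, (matrixForm (A n)).onStiefel w ^ m ∂(stiefelMeasure n) =
        haarMean n (conjEntry (A n) ⟨0, by omega⟩ ⟨1, by omega⟩ ^ m) := fun hn m =>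
    BilinModI.integral_pow (by omega) _ (BilinModI.onStiefel_matrixForm _) m
  have hpos : ∀ {n : ℕ} (hn : 3 ≤ n),
      0 < ∫ w, (matrixForm (A n)).onStiefel w ^ 2 ∂(stiefelMeasure n) := by
    intro n hn
    rw [hint hn, hA hn, haarMean_single_sq hn _ (by simp)]
    positivity
  refine ⟨fun n => matrixForm (A n), fun n hn => ⟨⟨A n, ?_, rfl⟩,
    BilinModI.stiefelNorm_two_pos _ (hpos hn)⟩, ?_⟩
  · rw [hA hn, Matrix.transpose_single]
  · simp only [BilinModI.stiefelNorm_div]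
    rw [← rpow_quarter_nine]
    refine Filter.Tendsto.rpow_const ?_ (Or.inr (by norm_num))
    have hlow : Filter.Tendsto (fun n : ℕ => 9 * (((n : ℝ) / (n - 1)) * ((n + 2) / (n + 1)) *
        ((n - 6) / (n + 4)))) Filter.atTop (nhds 9) := by
      have h1 := tendsto_natCast_add_div_natCast_add 0 (-1)
      have h2 := tendsto_natCast_add_div_natCast_add 2 1
      have h3 := tendsto_natCast_add_div_natCast_add (-6) 4
      simpa [sub_eq_add_neg] using ((h1.mul h2).mul h3).const_mul 9
    refine tendsto_of_tendsto_of_tendsto_of_le_of_le' hlow tendsto_const_nhds ?_ ?_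
    · filter_upwards [Filter.eventually_ge_atTop 3] with n hn
      rw [le_div_iff₀ (pow_pos (hpos hn) 2), hint hn, hint hn, hA hn]
      exact le_haarMean_single_pow_four hn _ (by simp)
    · filter_upwards [Filter.eventually_ge_atTop 3] with n hn
      rw [div_le_iff₀ (pow_pos (hpos hn) 2)]
      exact BilinModI.integral_pow_four_le hn _

/-- The constant `6^(1/4)` is asymptotically attained by the form `x₁ y₂ - x₂ y₁`. -/
theorem exists_skewSymmetric_tendsto :
    ∃ g : (n : ℕ) → BilinModI n,
      (∀ n : ℕ, 3 ≤ n → (g n).IsSkewSymmetric ∧ 0 < (g n).stiefelNorm 2) ∧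
      Filter.Tendsto (fun n : ℕ => (g n).stiefelNorm 4 / (g n).stiefelNorm 2)
        Filter.atTop (nhds ((6 : ℝ) ^ (1 / 4 : ℝ))) := by
  let A : (n : ℕ) → Matrix (Fin n) (Fin n) ℝ := fun n =>
    if h : 3 ≤ n then Matrix.single ⟨0, by omega⟩ ⟨1, by omega⟩ 1 -
      Matrix.single ⟨1, by omega⟩ ⟨0, by omega⟩ 1 else 0
  have hA : ∀ {n : ℕ} (hn : 3 ≤ n), A n = Matrix.single ⟨0, by omega⟩ ⟨1, by omega⟩ 1 -
      Matrix.single ⟨1, by omega⟩ ⟨0, by omega⟩ 1 := fun hn => dif_pos hn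
  have hint : ∀ {n : ℕ} (hn : 3 ≤ n) (m : ℕ),
      ∫ w, (matrixForm (A n)).onStiefel w ^ m ∂(stiefelMeasure n) =
        haarMean n (conjEntry (A n) ⟨0, by omega⟩ ⟨1, by omega⟩ ^ m) := fun hn m =>
    BilinModI.integral_pow (by omega) _ (BilinModI.onStiefel_matrixForm _) m
  have hpos : ∀ {n : ℕ} (hn : 3 ≤ n),
      0 < ∫ w, (matrixForm (A n)).onStiefel w ^ 2 ∂(stiefelMeasure n) := by
    intro n hn
    have hn' : (3 : ℝ) ≤ n := by exact_mod_cast hn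
    have hn1 : (0 : ℝ) < n - 1 := by linarith
    rw [hint hn, hA hn, haarMean_skewUnit_sq hn (by simp) (by simp)]
    positivity
  refine ⟨fun n => matrixForm (A n), fun n hn => ⟨⟨A n, ?_, rfl⟩,
    BilinModI.stiefelNorm_two_pos _ (hpos hn)⟩, ?_⟩
  · rw [hA hn, skewUnit_transpose]
  · simp only [BilinModI.stiefelNorm_div]
    refine Filter.Tendsto.rpow_const ?_ (Or.inr (by norm_num))
    have hlim : Filter.Tendsto (fun n : ℕ => 6 * (((n : ℝ) - 1) / (n + 1) * (n / (n + 2))))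
        Filter.atTop (nhds 6) := by
      have h1 := tendsto_natCast_add_div_natCast_add (-1) 1
      have h2 := tendsto_natCast_add_div_natCast_add 0 2
      simpa [sub_eq_add_neg] using (h1.mul h2).const_mul 6
    refine hlim.congr' ?_
    filter_upwards [Filter.eventually_ge_atTop 3] with n hn
    rw [eq_div_iff (pow_pos (hpos hn) 2).ne', hint hn, hint hn, hA hn]
    exact (haarMean_skewUnit_pow_four hn (by simp) (by simp)).symm

end

theorem mainTheorem10 :
    -- the general bound
    (∀ n : ℕ, 3 ≤ n → ∀ g : BilinModI n,
      (∫ w, g.onStiefel w ^ 4 ∂(stiefelMeasure n)) ^ (1 / 4 : ℝ) = g.stiefelNorm 4 ∧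
      g.stiefelNorm 4 ≤ Real.sqrt 6 * g.stiefelNorm 2 ∧
      g.stiefelNorm 2 = (∫ w, g.onStiefel w ^ 2 ∂(stiefelMeasure n)) ^ (1 / 2 : ℝ)) ∧
    -- the bounds for symmetric and for skew-symmetric forms
    (∀ n : ℕ, 3 ≤ n → ∀ g : BilinModI n, g.IsSymmetric →
      g.stiefelNorm 4 ≤ Real.sqrt 3 * g.stiefelNorm 2) ∧
    (∀ n : ℕ, 3 ≤ n → ∀ g : BilinModI n, g.IsSkewSymmetric →
      g.stiefelNorm 4 ≤ (6 : ℝ) ^ (1 / 4 : ℝ) * g.stiefelNorm 2) ∧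
    -- asymptotic sharpness of the last two constants
    (∃ g : (n : ℕ) → BilinModI n,
      (∀ n : ℕ, 3 ≤ n → (g n).IsSymmetric ∧ 0 < (g n).stiefelNorm 2) ∧
      Filter.Tendsto (fun n : ℕ => (g n).stiefelNorm 4 / (g n).stiefelNorm 2)
        Filter.atTop (nhds (Real.sqrt 3))) ∧
    (∃ g : (n : ℕ) → BilinModI n,
      (∀ n : ℕ, 3 ≤ n → (g n).IsSkewSymmetric ∧ 0 < (g n).stiefelNorm 2) ∧
      Filter.Tendsto (fun n : ℕ => (g n).stiefelNorm 4 / (g n).stiefelNorm 2)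
        Filter.atTop (nhds ((6 : ℝ) ^ (1 / 4 : ℝ)))) := by
  refine ⟨fun n hn g => ⟨g.stiefelNorm_four.symm, ?_, g.stiefelNorm_two⟩,
    fun n hn g _ => g.stiefelNorm_four_le_sqrt_three hn, ?_,
    exists_symmetric_tendsto, exists_skewSymmetric_tendsto⟩
  · -- the constant `√3` of the symmetric case already works for every form
    refine (g.stiefelNorm_four_le_sqrt_three hn).trans ?_
    have h : 0 ≤ g.stiefelNorm 2 := lpNorm_nonneg
    gcongr
    norm_num
  · rintro n hn g ⟨A, hA, rfl⟩
    refine BilinModI.stiefelNorm_four_le _ (by norm_num) ?_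
    rw [BilinModI.integral_pow (by omega) _ (BilinModI.onStiefel_matrixForm A),
      BilinModI.integral_pow (by omega) _ (BilinModI.onStiefel_matrixForm A)]
    exact haarMean_pow_four_le_of_skew hn hA (by simp)
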